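/- Let $\Bbbk$ be an algebraically closed field of characteristic zero, let $\alpha,\beta,\gamma\in\Bbbk$ with $\beta\neq 0$, and let $A=A(\alpha,\beta,\gamma)$ be the down-up algebra, that is, the $\Bbbk$-algebra generated by $d,u$ subject to the relations $$d^2u=\alpha\, dud+\beta\, ud^2+\gamma\, d,\qquad du^2=\alpha\, udu+\beta\, u^2d+\gamma\, u$$ (the condition $\beta\neq0$ is equivalent to $A$ being noetherian). Suppose that the two roots $r,s$ (with multiplicity) of $x^2-\alpha x-\beta$ in $\Bbbk$ are roots of unity of order at least $2$. Then $A$ is congenial with respect to the standard filtration $\mathcal F$, whose $n$-th step $\mathcal F_n$ is the span of the products of at most $n$ of the generators $d,u$. Here a $\Bbbk$-algebra $A$ with an exhaustive $\mathbb N$-filtration $\mathcal F$ is called congenial if the following hold. Every $\mathcal F_n$ is finite-dimensional, and there are a subring $D\subseteq\Bbbk$ that is finitely generated as a ring and a $D$-subalgebra $A_D\subseteq A$ such that: (1) $A_D$ is an order of $A$, i.e. $A_D$ is free over $D$ and the natural map $A_D\otimes_D\Bbbk\to A$ is an isomorphism; moreover, for the induced filtration $A_D\cap\mathcal F_n$,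 every step is a finitely generated $D$-module; (2) the associated graded ring $\operatorname{gr}_{\mathcal F}A_D$ is an order of $\operatorname{gr}_{\mathcal F}A$ via the natural map; (3) $\operatorname{gr}_{\mathcal F}A_D$ is strongly noetherian over $D$, i.e. $\operatorname{gr}_{\mathcal F}A_D\otimes_D C$ is (left and right) noetherian for every commutative noetherian $D$-algebra $C$, and each of its homogeneous components is a finitely generated $D$-module; (4) for every factor ring $F$ of $D$ that is a finite field, $A_D\otimes_D F$ is a finitely generated, (left and right) noetherian $F$-algebra satisfying a polynomial identity. -/

import Mathlib

open scoped TensorProduct DirectSum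

universe v u w

/-! ### `ℕ`-filtrations -/

/-- An exhaustive, multiplicative, increasing `ℕ`-filtration `F 0 ⊆ F 1 ⊆ ⋯` of an `R`-algebra `A`
by `R`-submodules, with `1 ∈ F 0`. -/
structure NFiltration (R : Type*) (A : Type*) [CommRing R] [Ring A] [Algebra R A] where
  toFun : ℕ → Submodule R A
  mono' : ∀ n, toFun n ≤ toFun (n + 1)
  one_mem' : (1 : A) ∈ toFun 0
  mul_mem' : ∀ {i j : ℕ} {a b : A}, a ∈ toFun i → b ∈ toFun j → a * b ∈ toFun (i + j)
  exhaustive' : ∀ a : A, ∃ n, a ∈ toFun n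

namespace NFiltration

section Basic

variable {R : Type*} {A : Type*} [CommRing R] [Ring A] [Algebra R A]

/-- The standard filtration attached to a set `S` of algebra generators: all elements of `S` are
put in degree one, so the `n`-th step is spanned by the products of at most `n` elements
of `S`. -/
def ofGenerators (S : Set A) (hS : Algebra.adjoin R S = ⊤) : NFiltration R A where
  toFun n := Submodule.span R (insert 1 S) ^ n
  mono' n := by
    rw [pow_succ]
    intro a ha
    have h := Submodule.mul_mem_mul ha
      (Submodule.subset_span (R := R) (Set.mem_insert (1 : A) S))
    rwa [mul_one] at h
  one_mem' := by
    rw [pow_zero]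
    exact Submodule.one_le.mp le_rfl
  mul_mem' ha hb := by
    rw [pow_add]
    exact Submodule.mul_mem_mul ha hb
  exhaustive' a := by
    have hmono : Monotone fun n : ℕ => Submodule.span R (insert (1 : A) S) ^ n := by
      refine monotone_nat_of_le_succ fun n a ha => ?_
      have h := Submodule.mul_mem_mul ha
        (Submodule.subset_span (R := R) (Set.mem_insert (1 : A) S))
      rw [mul_one] at h
      simpa only [pow_succ] using h
    have ha : a ∈ Algebra.adjoin R S := by rw [hS]; trivial
    induction ha using Algebra.adjoin_induction with
    | mem x hx =>
      exact ⟨1, by rw [pow_one]; exact Submodule.subset_span (Set.mem_insert_of_mem _ hx)⟩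
    | algebraMap r =>
      exact ⟨0, by rw [pow_zero]; exact Submodule.algebraMap_mem r⟩
    | add x y _ _ hx hy =>
      obtain ⟨m, hm⟩ := hx
      obtain ⟨n, hn⟩ := hy
      exact ⟨max m n, add_mem (hmono (le_max_left m n) hm) (hmono (le_max_right m n) hn)⟩
    | mul x y _ _ hx hy =>
      obtain ⟨m, hm⟩ := hx
      obtain ⟨n, hn⟩ := hy
      exact ⟨m + n, by rw [pow_add]; exact Submodule.mul_mem_mul hm hn⟩

variable (F : NFiltration R A)

/-- A filtration is locally finite if each of its steps is a finitely generated module. -/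
def IsLocallyFinite : Prop := ∀ n, Module.Finite R (F.toFun n)

/-- The step before the `n`-th one: `F (n - 1)`, with `F (-1) = 0`. -/
def prev : ℕ → Submodule R A
  | 0 => ⊥
  | n + 1 => F.toFun n

lemma mul_mem_prev_left {i j : ℕ} {a b : A} (ha : a ∈ F.prev i) (hb : b ∈ F.toFun j) :
    a * b ∈ F.prev (i + j) := by
  cases i with
  | zero =>
    have h : a = 0 := ha
    rw [h, zero_mul]
    exact zero_mem _
  | succ i =>
    rw [Nat.succ_add]
    exact F.mul_mem' ha hb

lemma mul_mem_prev_right {i j : ℕ} {a b : A} (ha : a ∈ F.toFun i) (hb : b ∈ F.prev j) :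
    a * b ∈ F.prev (i + j) := by
  cases j with
  | zero =>
    have h : b = 0 := hb
    rw [h, mul_zero]
    exact zero_mem _
  | succ j => exact F.mul_mem' ha hb

/-! ### The associated graded ring -/

/-- The degree `n` piece `F n / F (n - 1)` of the associated graded ring. -/
def GrPiece (n : ℕ) : Type _ := F.toFun n ⧸ (F.prev n).submoduleOf (F.toFun n)

instance (n : ℕ) : AddCommGroup (F.GrPiece n) :=
  inferInstanceAs (AddCommGroup (F.toFun n ⧸ (F.prev n).submoduleOf (F.toFun n)))

instance (n : ℕ) : Module R (F.GrPiece n) :=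
  inferInstanceAs (Module R (F.toFun n ⧸ (F.prev n).submoduleOf (F.toFun n)))

/-- The symbol in degree `n` of an element of `F n`. -/
def symbol (n : ℕ) (a : A) (ha : a ∈ F.toFun n) : F.GrPiece n :=
  Submodule.Quotient.mk ⟨a, ha⟩

lemma symbol_surj {n : ℕ} (x : F.GrPiece n) : ∃ a ha, F.symbol n a ha = x := by
  obtain ⟨⟨a, ha⟩, rfl⟩ := Submodule.Quotient.mk_surjective _ x
  exact ⟨a, ha, rfl⟩

lemma symbol_eq_iff {n : ℕ} {a b : A} (ha : a ∈ F.toFun n) (hb : b ∈ F.toFun n) :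
    F.symbol n a ha = F.symbol n b hb ↔ a - b ∈ F.prev n :=
  Submodule.Quotient.eq _

lemma mk_symbol_congr {i j : ℕ} {a b : A} (hij : i = j) (hab : a = b)
    (ha : a ∈ F.toFun i) (hb : b ∈ F.toFun j) :
    GradedMonoid.mk (A := F.GrPiece) i (F.symbol i a ha) =
      GradedMonoid.mk j (F.symbol j b hb) := by
  subst hij hab
  rfl

/-- Multiplication of graded pieces, induced by the multiplication `F i × F j → F (i + j)`. -/
def grMul {i j : ℕ} : F.GrPiece i → F.GrPiece j → F.GrPiece (i + j) :=
  Quotient.map₂ (fun a b => ⟨a.1 * b.1, F.mul_mem' a.2 b.2⟩) (by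
    intro a a' ha b b' hb
    have ha := (Submodule.quotientRel_def ((F.prev i).submoduleOf (F.toFun i))).mp ha
    have hb := (Submodule.quotientRel_def ((F.prev j).submoduleOf (F.toFun j))).mp hb
    change a.1 - a'.1 ∈ F.prev i at ha
    change b.1 - b'.1 ∈ F.prev j at hb
    refine (Submodule.quotientRel_def ((F.prev (i + j)).submoduleOf (F.toFun (i + j)))).mpr ?_
    change a.1 * b.1 - a'.1 * b'.1 ∈ F.prev (i + j)
    have h : a.1 * b.1 - a'.1 * b'.1 = (a.1 - a'.1) * b.1 + a'.1 * (b.1 - b'.1) := by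
      noncomm_ring
    rw [h]
    exact add_mem (F.mul_mem_prev_left ha b.2) (F.mul_mem_prev_right a'.2 hb))

lemma grMul_symbol {i j : ℕ} {a b : A} (ha : a ∈ F.toFun i) (hb : b ∈ F.toFun j) :
    F.grMul (F.symbol i a ha) (F.symbol j b hb) = F.symbol (i + j) (a * b) (F.mul_mem' ha hb) :=
  rfl

lemma symbol_add {n : ℕ} {a b : A} (ha : a ∈ F.toFun n) (hb : b ∈ F.toFun n) :
    F.symbol n a ha + F.symbol n b hb = F.symbol n (a + b) (add_mem ha hb) :=
  rfl

lemma symbol_zero (n : ℕ) : (0 : F.GrPiece n) = F.symbol n 0 (zero_mem _) :=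
  rfl

lemma symbol_smul {n : ℕ} (r : R) {a : A} (ha : a ∈ F.toFun n) :
    r • F.symbol n a ha = F.symbol n (r • a) (Submodule.smul_mem _ r ha) :=
  rfl

lemma algebraMap_mem_zero (r : R) : algebraMap R A r ∈ F.toFun 0 := by
  rw [Algebra.algebraMap_eq_smul_one]
  exact Submodule.smul_mem _ r F.one_mem'

instance grGMul : GradedMonoid.GMul F.GrPiece where
  mul := F.grMul

instance grGOne : GradedMonoid.GOne F.GrPiece where
  one := F.symbol 0 1 F.one_mem'

instance grGMonoid : GradedMonoid.GMonoid F.GrPiece where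
  one_mul := by
    rintro ⟨i, x⟩
    obtain ⟨a, ha, rfl⟩ := F.symbol_surj x
    exact F.mk_symbol_congr (zero_add i) (one_mul a) _ _
  mul_one := by
    rintro ⟨i, x⟩
    obtain ⟨a, ha, rfl⟩ := F.symbol_surj x
    exact F.mk_symbol_congr (add_zero i) (mul_one a) _ _
  mul_assoc := by
    rintro ⟨i, x⟩ ⟨j, y⟩ ⟨k, z⟩
    obtain ⟨a, ha, rfl⟩ := F.symbol_surj x
    obtain ⟨b, hb, rfl⟩ := F.symbol_surj y
    obtain ⟨c, hc, rfl⟩ := F.symbol_surj z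
    exact F.mk_symbol_congr (add_assoc i j k) (mul_assoc a b c) _ _

instance grGSemiring : DirectSum.GSemiring F.GrPiece where
  __ := F.grGMonoid
  mul_zero {i j} x := by
    obtain ⟨a, ha, rfl⟩ := F.symbol_surj x
    exact (F.symbol_eq_iff _ (zero_mem _)).mpr (by simp)
  zero_mul {i j} x := by
    obtain ⟨a, ha, rfl⟩ := F.symbol_surj x
    exact (F.symbol_eq_iff _ (zero_mem _)).mpr (by simp)
  mul_add {i j} x y z := by
    obtain ⟨a, ha, rfl⟩ := F.symbol_surj x
    obtain ⟨b, hb, rfl⟩ := F.symbol_surj y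
    obtain ⟨c, hc, rfl⟩ := F.symbol_surj z
    exact (F.symbol_eq_iff _ (add_mem (F.mul_mem' ha hb) (F.mul_mem' ha hc))).mpr (by
      simp [mul_add])
  add_mul {i j} x y z := by
    obtain ⟨a, ha, rfl⟩ := F.symbol_surj x
    obtain ⟨b, hb, rfl⟩ := F.symbol_surj y
    obtain ⟨c, hc, rfl⟩ := F.symbol_surj z
    exact (F.symbol_eq_iff _ (add_mem (F.mul_mem' ha hc) (F.mul_mem' hb hc))).mpr (by
      simp [add_mul])
  natCast n := n • F.symbol 0 1 F.one_mem'
  natCast_zero := zero_nsmul _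
  natCast_succ n := succ_nsmul _ n

instance grGRing : DirectSum.GRing F.GrPiece where
  intCast n := n • F.symbol 0 1 F.one_mem'
  intCast_ofNat n := natCast_zsmul _ n
  intCast_negSucc_ofNat n := negSucc_zsmul _ n

instance grGAlgebra : DirectSum.GAlgebra R F.GrPiece where
  toFun :=
    { toFun := fun r => F.symbol 0 (algebraMap R A r) (F.algebraMap_mem_zero r)
      map_zero' := by
        rw [symbol_zero, symbol_eq_iff]
        simp
      map_add' := fun r s => by
        rw [symbol_add, symbol_eq_iff]
        simp }
  map_one := by
    change F.symbol 0 (algebraMap R A 1) _ = F.symbol 0 1 F.one_mem'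
    rw [symbol_eq_iff]
    simp
  map_mul r s := F.mk_symbol_congr (add_zero 0).symm (map_mul (algebraMap R A) r s) _
    (F.mul_mem' (F.algebraMap_mem_zero r) (F.algebraMap_mem_zero s))
  commutes := by
    rintro r ⟨i, x⟩
    obtain ⟨a, ha, rfl⟩ := F.symbol_surj x
    exact F.mk_symbol_congr ((zero_add i).trans (add_zero i).symm) (Algebra.commutes r a)
      (F.mul_mem' (F.algebraMap_mem_zero r) ha) (F.mul_mem' ha (F.algebraMap_mem_zero r))
  smul_def := by
    rintro r ⟨i, x⟩
    obtain ⟨a, ha, rfl⟩ := F.symbol_surj x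
    exact F.mk_symbol_congr (zero_add i).symm (Algebra.smul_def r a)
      (Submodule.smul_mem _ r ha) (F.mul_mem' (F.algebraMap_mem_zero r) ha)

/-- The associated graded ring `gr_F A = ⨁ₙ F n / F (n - 1)`. -/
def AssocGraded : Type _ := ⨁ n, F.GrPiece n

noncomputable instance : Ring F.AssocGraded := inferInstanceAs (Ring (⨁ n, F.GrPiece n))

noncomputable instance : Algebra R F.AssocGraded :=
  inferInstanceAs (Algebra R (⨁ n, F.GrPiece n))

/-- The inclusion of the degree `n` piece in the associated graded ring. -/
noncomputable def grOf (n : ℕ) : F.GrPiece n →ₗ[R] F.AssocGraded :=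
  DirectSum.lof R ℕ F.GrPiece n

lemma grOf_mul {i j : ℕ} (x : F.GrPiece i) (y : F.GrPiece j) :
    F.grOf i x * F.grOf j y = F.grOf (i + j) (F.grMul x y) :=
  DirectSum.of_mul_of x y

lemma grOf_one : F.grOf 0 (F.symbol 0 1 F.one_mem') = 1 :=
  rfl

end Basic

/-! ### Induced filtrations on subalgebras over a subring of the base field -/

section Induced

variable {𝕜 : Type*} [Field 𝕜] {A : Type*} [Ring A] [Algebra 𝕜 A]

/-- The filtration induced on a `D`-subalgebra `B` of `A`: its `n`-th step is `B ∩ F n`. -/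
def induced (F : NFiltration 𝕜 A) {D : Subring 𝕜} (B : Subalgebra D A) : NFiltration D B where
  toFun n := ((F.toFun n).restrictScalars D).comap B.val.toLinearMap
  mono' n _ ha := F.mono' n ha
  one_mem' := F.one_mem'
  mul_mem' ha hb := F.mul_mem' ha hb
  exhaustive' a := F.exhaustive' (a : A)

lemma mem_induced (F : NFiltration 𝕜 A) {D : Subring 𝕜} (B : Subalgebra D A) (n : ℕ) (a : B) :
    a ∈ (F.induced B).toFun n ↔ (a : A) ∈ F.toFun n :=
  Iff.rfl

lemma mem_induced_prev (F : NFiltration 𝕜 A) {D : Subring 𝕜} (B : Subalgebra D A) (n : ℕ) (a : B) :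
    a ∈ (F.induced B).prev n ↔ (a : A) ∈ F.prev n := by
  cases n with
  | zero => exact ⟨fun h => congrArg Subtype.val h, fun h => Subtype.ext h⟩
  | succ n => exact Iff.rfl

/-- The canonical map `(B ∩ F n) / (B ∩ F (n - 1)) → F n / F (n - 1) ⊆ gr_F A`. -/
noncomputable def grPieceMap (F : NFiltration 𝕜 A) {D : Subring 𝕜} (B : Subalgebra D A) (n : ℕ) :
    (F.induced B).GrPiece n →ₗ[D] F.AssocGraded :=
  Submodule.liftQ _
    { toFun := fun a => F.grOf n (F.symbol n (a.1 : A) ((F.mem_induced B n a.1).mp a.2))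
      map_add' := fun a b => by
        rw [← map_add]
        rfl
      map_smul' := fun c a => by
        change _ = (c : 𝕜) • F.grOf n (F.symbol n (a.1 : A) ((F.mem_induced B n a.1).mp a.2))
        rw [← map_smul]
        rfl } (by
    intro a ha
    have h : (a.1 : A) ∈ F.prev n := (F.mem_induced_prev B n a.1).mp ha
    rw [LinearMap.mem_ker]
    change F.grOf n (F.symbol n (a.1 : A) ((F.mem_induced B n a.1).mp a.2)) = 0
    have h0 : F.symbol n (a.1 : A) ((F.mem_induced B n a.1).mp a.2) = 0 := by
      rw [symbol_zero, symbol_eq_iff, sub_zero]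
      exact h
    rw [h0, map_zero])

/-- The canonical homomorphism of graded rings `gr_F B → gr_F A`, where `B` carries the induced
filtration. -/
noncomputable def grMap (F : NFiltration 𝕜 A) {D : Subring 𝕜} (B : Subalgebra D A) :
    (F.induced B).AssocGraded →ₐ[D] F.AssocGraded :=
  DirectSum.toAlgebra D (F.induced B).GrPiece (F.grPieceMap B) F.grOf_one (by
    intro i j x y
    obtain ⟨a, ha, rfl⟩ := (F.induced B).symbol_surj x
    obtain ⟨b, hb, rfl⟩ := (F.induced B).symbol_surj y
    exact (F.grOf_mul (F.symbol i (a : A) ((F.mem_induced B i a).mp ha))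
      (F.symbol j (b : A) ((F.mem_induced B j b).mp hb))).symm)

lemma grMap_grOf_symbol (F : NFiltration 𝕜 A) {D : Subring 𝕜} (B : Subalgebra D A) (n : ℕ) (a : B)
    (ha : a ∈ (F.induced B).toFun n) :
    F.grMap B ((F.induced B).grOf n ((F.induced B).symbol n a ha)) =
      F.grOf n (F.symbol n (a : A) ((F.mem_induced B n a).mp ha)) :=
  DirectSum.toModule_lof D n _

end Induced

end NFiltration

/-! ### Ring-theoretic notions for noncommutative algebras -/

/-- A ring is noetherian if it is both left and right noetherian. -/
def IsLeftRightNoetherian (B : Type*) [Ring B] : Prop :=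
  IsNoetherianRing B ∧ IsNoetherianRing Bᵐᵒᵖ

/-- An `R`-algebra `B` is strongly noetherian if `B ⊗[R] C` is noetherian for every commutative
noetherian `R`-algebra `C`. -/
def IsStronglyNoetherian (R : Type u) (B : Type w) [CommRing R] [Ring B] [Algebra R B] :
    Prop :=
  ∀ (C : Type v) [CommRing C] [Algebra R C], IsNoetherianRing C → IsLeftRightNoetherian (B ⊗[R] C)

/-- An algebra `B` over a field `K` is PI if some nonzero noncommutative polynomial over `K`
vanishes under all substitutions of elements of `B` for the variables. -/
def IsPIAlgebra (K : Type*) (B : Type*) [CommRing K] [Ring B] [Algebra K B] : Prop :=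
  ∃ p : FreeAlgebra K ℕ, p ≠ 0 ∧ ∀ x : ℕ → B, FreeAlgebra.lift K x p = 0

/-- A homomorphism `f : B → A` of `D`-algebras, where `D ⊆ 𝕜` and `A` is a `𝕜`-algebra, identifies
`B` with an order of `A`: `f` is injective, `B` is free over `D`, and the natural map
`𝕜 ⊗[D] B → A` is bijective. -/
def IsOrderMap {𝕜 : Type*} [Field 𝕜] {D : Subring 𝕜} {A B : Type*} [Ring A] [Algebra 𝕜 A]
    [Ring B] [Algebra D B] (f : B →ₐ[D] A) : Prop :=
  Function.Injective f ∧ Module.Free D B ∧ IsBaseChange 𝕜 f.toLinearMap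

/-- A `D`-subalgebra `B` of a `𝕜`-algebra `A` is an order of `A`. -/
def IsOrder {𝕜 : Type*} [Field 𝕜] {D : Subring 𝕜} {A : Type*} [Ring A] [Algebra 𝕜 A]
    (B : Subalgebra D A) : Prop :=
  IsOrderMap B.val

/-! ### Congenial algebras -/

/-- The conditions in the definition of congeniality that involve a subring `D` of `𝕜` and a
`D`-subalgebra `B` of `A`. -/
structure IsCongenialOrder {𝕜 : Type u} [Field 𝕜] {A : Type w} [Ring A] [Algebra 𝕜 A]
    (F : NFiltration 𝕜 A) {D : Subring 𝕜} (B : Subalgebra D A) : Prop where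
  /-- `D` is a finitely generated ring, i.e. affine over the prime ring. -/
  affine : Algebra.FiniteType ℤ D
  order : IsOrder B
  locallyFinite : (F.induced B).IsLocallyFinite
  gr_order : IsOrderMap (F.grMap B)
  gr_stronglyNoetherian : IsStronglyNoetherian.{v} D (F.induced B).AssocGraded
  gr_locallyFinite : ∀ n, Module.Finite D ((F.induced B).GrPiece n)
  affine_residue : ∀ I : Ideal D, IsField (D ⧸ I) → Finite (D ⧸ I) →
    Algebra.FiniteType (D ⧸ I) ((D ⧸ I) ⊗[D] B)
  noetherian_residue : ∀ I : Ideal D, IsField (D ⧸ I) → Finite (D ⧸ I) →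
    IsLeftRightNoetherian ((D ⧸ I) ⊗[D] B)
  pi_residue : ∀ I : Ideal D, IsField (D ⧸ I) → Finite (D ⧸ I) →
    IsPIAlgebra (D ⧸ I) ((D ⧸ I) ⊗[D] B)

/-- A `𝕜`-algebra `A` is congenial for the filtration `F`. -/
def IsCongenial {𝕜 : Type u} [Field 𝕜] {A : Type w} [Ring A] [Algebra 𝕜 A]
    (F : NFiltration 𝕜 A) : Prop :=
  F.IsLocallyFinite ∧ ∃ (D : Subring 𝕜) (B : Subalgebra D A), IsCongenialOrder.{v} F B

/-! ### Down-up algebras -/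

/-- The two generators of a down-up algebra. -/
inductive DownUpGen : Type
  | d : DownUpGen
  | u : DownUpGen

namespace FreeDownUp

/-- The free generator `d`. -/
abbrev d (R : Type*) [CommRing R] : FreeAlgebra R DownUpGen := FreeAlgebra.ι R DownUpGen.d

/-- The free generator `u`. -/
abbrev u (R : Type*) [CommRing R] : FreeAlgebra R DownUpGen := FreeAlgebra.ι R DownUpGen.u

end FreeDownUp

open FreeDownUp in
/-- The defining relations `d²u = α dud + β ud² + γ d` and `du² = α udu + β u²d + γ u` of the
down-up algebra `A(α, β, γ)`. -/
inductive DownUpRel {R : Type*} [CommRing R] (α β γ : R) :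
    FreeAlgebra R DownUpGen → FreeAlgebra R DownUpGen → Prop
  | ddu : DownUpRel α β γ (d R ^ 2 * u R)
      (α • (d R * u R * d R) + β • (u R * d R ^ 2) + γ • d R)
  | duu : DownUpRel α β γ (d R * u R ^ 2)
      (α • (u R * d R * u R) + β • (u R ^ 2 * d R) + γ • u R)

/-- The down-up algebra `A(α, β, γ)` over `R`. -/
abbrev DownUpAlgebra {R : Type*} [CommRing R] (α β γ : R) : Type _ := RingQuot (DownUpRel α β γ)

namespace DownUpAlgebra

variable {R : Type*} [CommRing R] (α β γ : R)

/-- The generator `d`. -/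
noncomputable def d : DownUpAlgebra α β γ :=
  RingQuot.mkAlgHom R (DownUpRel α β γ) (FreeAlgebra.ι R DownUpGen.d)

/-- The generator `u`. -/
noncomputable def u : DownUpAlgebra α β γ :=
  RingQuot.mkAlgHom R (DownUpRel α β γ) (FreeAlgebra.ι R DownUpGen.u)

lemma adjoin_d_u : Algebra.adjoin R {d α β γ, u α β γ} = ⊤ := by
  have h : ({d α β γ, u α β γ} : Set (DownUpAlgebra α β γ)) =
      RingQuot.mkAlgHom R (DownUpRel α β γ) '' Set.range (FreeAlgebra.ι R) := by
    ext x
    constructor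
    · rintro (rfl | rfl)
      · exact ⟨_, ⟨DownUpGen.d, rfl⟩, rfl⟩
      · exact ⟨_, ⟨DownUpGen.u, rfl⟩, rfl⟩
    · rintro ⟨_, ⟨g, rfl⟩, rfl⟩
      cases g
      · exact Or.inl rfl
      · exact Or.inr rfl
  rw [h, Algebra.adjoin_image, FreeAlgebra.adjoin_range_ι, Algebra.map_top]
  exact (AlgHom.range_eq_top _).mpr (RingQuot.mkAlgHom_surjective R _)

/-- The standard filtration of a down-up algebra, with `d` and `u` in degree one. -/
noncomputable def standardFiltration : NFiltration R (DownUpAlgebra α β γ) :=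
  NFiltration.ofGenerators {d α β γ, u α β γ} (adjoin_d_u α β γ)

end DownUpAlgebra

/-!
In `A(α, β, γ)` the elements `ud` and `du` commute, and since `β` is a unit, moving `d` or `u`
past a polynomial in them costs an affine automorphism `σ` of `R[X₀, X₁]` or its inverse. So `A`
arises from the image of `R[X₀, X₁]` by adjoining `u` and then `d`, and Hilbert's basis argument
shows that `A` is noetherian over any noetherian `R`. Over a finite `R`, `σ` has finite order `n`,
the elements `dⁿ`, `uⁿ` and the `σ`-invariant polynomials are central, and `A` is finite over its
center, so that alternating sums of long enough products vanish.

The monomials `(ud)ⁱ(du)ʲtₖ`, with `tₖ = dᵏ` or `u⁻ᵏ`, form a basis adapted to the filtration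
over every base ring, their independence being visible on a module of weighted shifts. Taking for
`D` the ring generated by `α`, `β`, `β⁻¹`, `γ`, they are a common basis of `A_D` and `A`, and their
symbols are one of the associated graded rings. The symbols of `d` and `u` satisfy the relations
with `γ = 0`, so `gr A_D` is noetherian after every noetherian base change for the same reason.
-/

/-! ### A skew Hilbert basis theorem -/

section PolyLT

variable {R S : Type*} [Ring R] [Ring S] (f : R →+* S) (x : S)

/-- The sums `∑ i < n, x ^ i * f (r i)`, that is, the polynomials in `x` of degree less than `n`
with coefficients from `R` written on the right. -/
def polyLT : ℕ → AddSubgroup S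
  | 0 => ⊥
  | n + 1 => polyLT n ⊔ ((AddMonoidHom.mulLeft (x ^ n)).comp f.toAddMonoidHom).range

lemma mem_polyLT_zero {v : S} : v ∈ polyLT f x 0 ↔ v = 0 :=
  AddSubgroup.mem_bot

lemma mem_polyLT_succ {n : ℕ} {s : S} :
    s ∈ polyLT f x (n + 1) ↔ ∃ v ∈ polyLT f x n, ∃ r, v + x ^ n * f r = s := by
  simp [polyLT, AddSubgroup.mem_sup]

lemma polyLT_mono : Monotone (polyLT f x) :=
  monotone_nat_of_le_succ fun _ => le_sup_left

lemma pow_mul_map_mem_polyLT (n : ℕ) (r : R) : x ^ n * f r ∈ polyLT f x (n + 1) :=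
  (mem_polyLT_succ f x).mpr ⟨0, zero_mem _, r, zero_add _⟩

lemma mul_map_mem_polyLT {n : ℕ} {v : S} (hv : v ∈ polyLT f x n) (r : R) :
    v * f r ∈ polyLT f x n := by
  induction n generalizing v with
  | zero => simp_all [mem_polyLT_zero]
  | succ n ih =>
    obtain ⟨v, hv', t, rfl⟩ := (mem_polyLT_succ f x).mp hv
    exact (mem_polyLT_succ f x).mpr ⟨v * f r, ih hv', t * r, by rw [map_mul]; noncomm_ring⟩

lemma mul_mem_polyLT_succ {n : ℕ} {v : S} (hv : v ∈ polyLT f x n) :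
    x * v ∈ polyLT f x (n + 1) := by
  induction n generalizing v with
  | zero => simp_all [mem_polyLT_zero]
  | succ n ih =>
    obtain ⟨v, hv', t, rfl⟩ := (mem_polyLT_succ f x).mp hv
    exact (mem_polyLT_succ f x).mpr ⟨x * v, ih hv', t, by rw [pow_succ']; noncomm_ring⟩

end PolyLT

/-- The element `x` almost normalizes the image of `f : R →+* S`: one has `x R + R = R x + R`
inside `S`. -/
structure IsAlmostNormalizing {R S : Type*} [Ring R] [Ring S] (f : R →+* S) (x : S) : Prop where
  exists_mul_map : ∀ r, ∃ a b, x * f r = f a * x + f b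
  exists_map_mul : ∀ r, ∃ a b, f r * x = x * f a + f b

namespace IsAlmostNormalizing

variable {R S : Type*} [Ring R] [Ring S] {f : R →+* S} {x : S}

lemma mul_self_mem_polyLT_succ (h : IsAlmostNormalizing f x) {n : ℕ} {v : S}
    (hv : v ∈ polyLT f x n) : v * x ∈ polyLT f x (n + 1) := by
  induction n generalizing v with
  | zero => simp_all [mem_polyLT_zero]
  | succ n ih =>
    obtain ⟨v, hv', t, rfl⟩ := (mem_polyLT_succ f x).mp hv
    obtain ⟨a, b, hab⟩ := h.exists_map_mul t
    refine (mem_polyLT_succ f x).mpr ⟨v * x + x ^ n * f b,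
      add_mem (ih hv') (pow_mul_map_mem_polyLT f x n b), a, ?_⟩
    rw [add_mul, mul_assoc, hab, pow_succ]
    noncomm_ring

lemma exists_map_mul_pow (h : IsAlmostNormalizing f x) (n : ℕ) (r : R) :
    ∃ a, ∃ v ∈ polyLT f x n, f r * x ^ n = x ^ n * f a + v := by
  induction n with
  | zero => exact ⟨r, 0, zero_mem _, by simp⟩
  | succ n ih =>
    obtain ⟨a, v, hv, ha⟩ := ih
    obtain ⟨a', b, hab⟩ := h.exists_map_mul a
    refine ⟨a', x ^ n * f b + v * x,
      add_mem (pow_mul_map_mem_polyLT f x n b) (h.mul_self_mem_polyLT_succ hv), ?_⟩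
    rw [pow_succ, ← mul_assoc, ha, add_mul, mul_assoc, hab]
    noncomm_ring

lemma exists_pow_mul_map (h : IsAlmostNormalizing f x) (n : ℕ) (r : R) :
    ∃ a, ∃ v ∈ polyLT f x n, x ^ n * f r = f a * x ^ n + v := by
  induction n generalizing r with
  | zero => exact ⟨r, 0, zero_mem _, by simp⟩
  | succ n ih =>
    obtain ⟨a, b, hab⟩ := h.exists_mul_map r
    obtain ⟨a', v, hv, ha⟩ := ih a
    refine ⟨a', v * x + x ^ n * f b,
      add_mem (h.mul_self_mem_polyLT_succ hv) (pow_mul_map_mem_polyLT f x n b), ?_⟩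
    rw [pow_succ, mul_assoc, hab, mul_add, ← mul_assoc, ha]
    noncomm_ring

lemma map_mul_mem_polyLT (h : IsAlmostNormalizing f x) {n : ℕ} {v : S} (hv : v ∈ polyLT f x n)
    (r : R) : f r * v ∈ polyLT f x n := by
  induction n generalizing v with
  | zero => simp_all [mem_polyLT_zero]
  | succ n ih =>
    obtain ⟨v, hv', t, rfl⟩ := (mem_polyLT_succ f x).mp hv
    obtain ⟨a, w, hw, ha⟩ := h.exists_map_mul_pow n r
    refine (mem_polyLT_succ f x).mpr ⟨f r * v + w * f t,
      add_mem (ih hv') (mul_map_mem_polyLT f x hw t), a * t, ?_⟩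
    rw [mul_add, ← mul_assoc, ha, map_mul]
    noncomm_ring

lemma exists_mem_polyLT (h : IsAlmostNormalizing f x)
    (hgen : Subring.closure (insert x (Set.range f)) = ⊤) (s : S) : ∃ n, s ∈ polyLT f x n := by
  have mem_iSup (v : S) : v ∈ ⨆ n, polyLT f x n ↔ ∃ n, v ∈ polyLT f x n :=
    AddSubgroup.mem_iSup_of_directed (polyLT_mono f x).directed_le
  have left_ideal : ∀ v ∈ ⨆ n, polyLT f x n, s * v ∈ ⨆ n, polyLT f x n := by
    have hs : s ∈ Subring.closure (insert x (Set.range f)) := hgen ▸ Subring.mem_top s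
    induction hs using Subring.closure_induction with
    | mem s hs =>
      intro v hv
      obtain ⟨n, hn⟩ := (mem_iSup v).mp hv
      rcases hs with rfl | ⟨r, rfl⟩
      · exact (mem_iSup _).mpr ⟨n + 1, mul_mem_polyLT_succ f s hn⟩
      · exact (mem_iSup _).mpr ⟨n, h.map_mul_mem_polyLT hn r⟩
    | zero => simp
    | one => simp
    | add s t _ _ hs ht => exact fun v hv => by rw [add_mul]; exact add_mem (hs v hv) (ht v hv)
    | neg s _ hs => exact fun v hv => by rw [neg_mul]; exact neg_mem (hs v hv)
    | mul s t _ _ hs ht => exact fun v hv => by rw [mul_assoc]; exact hs _ (ht v hv)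
  have one_mem : (1 : S) ∈ polyLT f x 1 := by simpa using pow_mul_map_mem_polyLT f x 0 1
  rw [← mem_iSup]
  simpa using left_ideal 1 ((mem_iSup 1).mpr ⟨1, one_mem⟩)

/-- The left ideal of leading coefficients of the elements of degree at most `n` of a left
ideal `I`: the `r` for which `I` contains some `x ^ n * f r + (lower terms)`. -/
def leadingIdeal (h : IsAlmostNormalizing f x) (I : Ideal S) (n : ℕ) : Ideal R where
  carrier := {r | ∃ v ∈ polyLT f x n, x ^ n * f r + v ∈ I}
  zero_mem' := ⟨0, zero_mem _, by simp⟩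
  add_mem' := by
    rintro r r' ⟨v, hv, hr⟩ ⟨v', hv', hr'⟩
    refine ⟨v + v', add_mem hv hv', ?_⟩
    convert add_mem hr hr' using 1
    rw [map_add]
    noncomm_ring
  smul_mem' := by
    rintro t r ⟨v, hv, hr⟩
    obtain ⟨a, w, hw, ha⟩ := h.exists_pow_mul_map n t
    refine ⟨f a * v - w * f r,
      sub_mem (h.map_mul_mem_polyLT hv a) (mul_map_mem_polyLT f x hw r), ?_⟩
    convert I.mul_mem_left (f a) hr using 1
    rw [smul_eq_mul, map_mul, ← mul_assoc, ha]
    noncomm_ring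

lemma leadingIdeal_mono (h : IsAlmostNormalizing f x) {I J : Ideal S} (hIJ : I ≤ J) {m n : ℕ}
    (hmn : m ≤ n) : h.leadingIdeal I m ≤ h.leadingIdeal J n := by
  have mono_degree : Monotone (h.leadingIdeal I) := by
    refine monotone_nat_of_le_succ fun n r => ?_
    rintro ⟨v, hv, hr⟩
    refine ⟨x * v, mul_mem_polyLT_succ f x hv, ?_⟩
    convert I.mul_mem_left x hr using 1
    rw [pow_succ']
    noncomm_ring
  refine (mono_degree hmn).trans ?_
  rintro r ⟨v, hv, hr⟩
  exact ⟨v, hv, hIJ hr⟩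

lemma eq_of_leadingIdeal_eq (h : IsAlmostNormalizing f x)
    (hgen : Subring.closure (insert x (Set.range f)) = ⊤) {I J : Ideal S} (hIJ : I ≤ J)
    (heq : ∀ n, h.leadingIdeal I n = h.leadingIdeal J n) : I = J := by
  have mem_of_polyLT : ∀ n, ∀ s ∈ J, s ∈ polyLT f x n → s ∈ I := by
    intro n
    induction n with
    | zero => simp +contextual [mem_polyLT_zero]
    | succ n ih =>
      intro s hs hsn
      obtain ⟨v, hv, r, rfl⟩ := (mem_polyLT_succ f x).mp hsn
      have hr : r ∈ h.leadingIdeal J n := ⟨v, hv, by rwa [add_comm]⟩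
      rw [← heq n] at hr
      obtain ⟨w, hw, hI⟩ := hr
      have hvw : v - w ∈ I := by
        refine ih _ ?_ (sub_mem hv hw)
        convert sub_mem hs (hIJ hI) using 1
        abel
      convert add_mem hvw hI using 1
      abel
  refine le_antisymm hIJ fun s hs => ?_
  obtain ⟨n, hn⟩ := h.exists_mem_polyLT hgen s
  exact mem_of_polyLT n s hs hn

theorem isNoetherianRing [IsNoetherianRing R] (h : IsAlmostNormalizing f x)
    (hgen : Subring.closure (insert x (Set.range f)) = ⊤) : IsNoetherianRing S := by
  refine monotone_stabilizes_iff_noetherian.mp fun I => ?_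
  have stabilizes (g : ℕ →o Ideal R) : ∃ N, ∀ k, N ≤ k → g N = g k :=
    monotone_stabilizes_iff_noetherian.mpr ‹IsNoetherianRing R› g
  obtain ⟨N, hN⟩ := stabilizes
    ⟨fun k => h.leadingIdeal (I k) k, fun a b hab => h.leadingIdeal_mono (I.monotone hab) hab⟩
  choose K hK using fun n => stabilizes
    ⟨fun k => h.leadingIdeal (I k) n, fun a b hab => h.leadingIdeal_mono (I.monotone hab) le_rfl⟩
  let M := max N ((Finset.range N).sup K)
  refine ⟨M, fun k hk => h.eq_of_leadingIdeal_eq hgen (I.monotone hk) fun n => ?_⟩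
  rcases lt_or_ge n N with hn | hn
  · have hKM : K n ≤ M :=
      (Finset.le_sup (f := K) (Finset.mem_range.mpr hn)).trans (le_max_right _ _)
    exact (hK n M hKM).symm.trans (hK n k (hKM.trans hk))
  · have eq_diagonal (j : ℕ) (hj : N ≤ j) :
        h.leadingIdeal (I j) n = h.leadingIdeal (I N) N := by
      refine le_antisymm ?_ (h.leadingIdeal_mono (I.monotone hj) hn)
      calc h.leadingIdeal (I j) n
          ≤ h.leadingIdeal (I (max j n)) (max j n) :=
            h.leadingIdeal_mono (I.monotone (le_max_left j n)) (le_max_right j n)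
        _ = h.leadingIdeal (I N) N := (hN _ (hj.trans (le_max_left _ _))).symm
    exact (eq_diagonal M (le_max_left _ _)).trans
      (eq_diagonal k ((le_max_left _ _).trans hk)).symm

end IsAlmostNormalizing

section Closure

variable {S : Type*} [Ring S] {s : Set S} {x : S}

lemma exists_left_mul_eq_of_mem_closure
    (h : ∀ r ∈ s, ∃ a ∈ Subring.closure s, ∃ b ∈ Subring.closure s, x * r = a * x + b) {r : S}
    (hr : r ∈ Subring.closure s) :
    ∃ a ∈ Subring.closure s, ∃ b ∈ Subring.closure s, x * r = a * x + b := by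
  induction hr using Subring.closure_induction with
  | mem r hr => exact h r hr
  | zero => exact ⟨0, zero_mem _, 0, zero_mem _, by simp⟩
  | one => exact ⟨1, one_mem _, 0, zero_mem _, by simp⟩
  | add r t _ _ hr ht =>
    obtain ⟨a, ha, b, hb, hab⟩ := hr
    obtain ⟨a', ha', b', hb', hab'⟩ := ht
    exact ⟨a + a', add_mem ha ha', b + b', add_mem hb hb', by
      rw [mul_add, hab, hab']; noncomm_ring⟩
  | neg r _ hr =>
    obtain ⟨a, ha, b, hb, hab⟩ := hr
    exact ⟨-a, neg_mem ha, -b, neg_mem hb, by rw [mul_neg, hab]; noncomm_ring⟩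
  | mul r t _ ht' hr ht =>
    obtain ⟨a, ha, b, hb, hab⟩ := hr
    obtain ⟨a', ha', b', hb', hab'⟩ := ht
    refine ⟨a * a', mul_mem ha ha', a * b' + b * t,
      add_mem (mul_mem ha hb') (mul_mem hb ht'), ?_⟩
    rw [← mul_assoc, hab, add_mul, mul_assoc, hab']
    noncomm_ring

lemma exists_right_mul_eq_of_mem_closure
    (h : ∀ r ∈ s, ∃ a ∈ Subring.closure s, ∃ b ∈ Subring.closure s, r * x = x * a + b) {r : S}
    (hr : r ∈ Subring.closure s) :
    ∃ a ∈ Subring.closure s, ∃ b ∈ Subring.closure s, r * x = x * a + b := by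
  have key := exists_left_mul_eq_of_mem_closure (s := MulOpposite.unop ⁻¹' s)
    (x := MulOpposite.op x) (r := MulOpposite.op r)
  simp only [← Subring.op_closure, Subring.mem_op, MulOpposite.exists, MulOpposite.forall,
    Set.mem_preimage, MulOpposite.unop_op, ← MulOpposite.op_mul, ← MulOpposite.op_add,
    MulOpposite.op_inj] at key
  exact key h hr

theorem isNoetherianRing_closure_insert [IsNoetherianRing (Subring.closure s)]
    (h₁ : ∀ r ∈ s, ∃ a ∈ Subring.closure s, ∃ b ∈ Subring.closure s, x * r = a * x + b)
    (h₂ : ∀ r ∈ s, ∃ a ∈ Subring.closure s, ∃ b ∈ Subring.closure s, r * x = x * a + b) :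
    IsNoetherianRing (Subring.closure (insert x s)) := by
  set T := Subring.closure (insert x s)
  have hsT : Subring.closure s ≤ T := Subring.closure_mono (Set.subset_insert x s)
  have hxT : x ∈ T := Subring.subset_closure (Set.mem_insert x s)
  have h : IsAlmostNormalizing (Subring.inclusion hsT) ⟨x, hxT⟩ :=
    { exists_mul_map := by
        rintro ⟨r, hr⟩
        obtain ⟨a, ha, b, hb, hab⟩ := exists_left_mul_eq_of_mem_closure h₁ hr
        exact ⟨⟨a, ha⟩, ⟨b, hb⟩, Subtype.ext hab⟩
      exists_map_mul := by
        rintro ⟨r, hr⟩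
        obtain ⟨a, ha, b, hb, hab⟩ := exists_right_mul_eq_of_mem_closure h₂ hr
        exact ⟨⟨a, ha⟩, ⟨b, hb⟩, Subtype.ext hab⟩ }
  have T_le : T ≤ (Subring.closure (insert ⟨x, hxT⟩
      (Set.range (Subring.inclusion hsT)))).map T.subtype := by
    refine Subring.closure_le.mpr ?_
    rintro y (rfl | hy)
    · exact ⟨_, Subring.subset_closure (Set.mem_insert _ _), rfl⟩
    · exact ⟨_, Subring.subset_closure
        (Set.mem_insert_of_mem _ ⟨⟨y, Subring.subset_closure hy⟩, rfl⟩), rfl⟩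
  refine h.isNoetherianRing (eq_top_iff.mpr fun y _ => ?_)
  obtain ⟨z, hz, hzy⟩ := T_le y.2
  rwa [← Subtype.ext hzy]

end Closure

/-! ### Pairs of elements satisfying the down-up relations -/

/-- The elements `d` and `u` of an `R`-algebra satisfy the relations of the down-up algebra
`A(α, β, γ)`. -/
structure IsDownUpPair {R S : Type*} [CommRing R] [Ring S] [Algebra R S] (α β γ : R) (d u : S) :
    Prop where
  ddu : d ^ 2 * u = α • (d * u * d) + β • (u * d ^ 2) + γ • d
  duu : d * u ^ 2 = α • (u * d * u) + β • (u ^ 2 * d) + γ • u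

section Twist

open MvPolynomial

variable {R : Type*} [CommRing R]

/-- The automorphism `X₀ ↦ X₁`, `X₁ ↦ α X₁ + β X₀ + γ` of the polynomial ring in two variables.
With `X₀` standing for `u d` and `X₁` for `d u`, it describes conjugation by `d`. -/
noncomputable def downUpTwist (α : R) (β : Rˣ) (γ : R) :
    MvPolynomial (Fin 2) R ≃ₐ[R] MvPolynomial (Fin 2) R :=
  AlgEquiv.ofAlgHom
    (aeval ![X 1, α • X 1 + (β : R) • X 0 + C γ])
    (aeval ![(↑β⁻¹ : R) • (X 1 - α • X 0 - C γ), X 0])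
    (by
      ext i : 1
      fin_cases i
      · simp only [Fin.zero_eta, AlgHom.coe_comp, Function.comp_apply, aeval_X, map_smul, map_sub,
          Matrix.cons_val_zero, Matrix.cons_val_one, algHom_C, algebraMap_eq, AlgHom.id_apply]
        rw [sub_right_comm, add_sub_cancel_right, add_sub_cancel_left, smul_smul, Units.inv_mul,
          one_smul]
      · simp)
    (by
      ext i : 1
      fin_cases i
      · simp
      · simp only [Fin.mk_one, AlgHom.coe_comp, Function.comp_apply, aeval_X, map_add, map_smul,
          Matrix.cons_val_zero, Matrix.cons_val_one, smul_smul, Units.mul_inv, one_smul,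
          algHom_C, algebraMap_eq, AlgHom.id_apply]
        ring)

variable (α : R) (β : Rˣ) (γ : R)

@[simp] lemma downUpTwist_X_zero : downUpTwist α β γ (X 0) = X 1 := by
  simp [downUpTwist]

@[simp] lemma downUpTwist_X_one :
    downUpTwist α β γ (X 1) = α • X 1 + (β : R) • X 0 + C γ := by
  simp [downUpTwist]

@[simp] lemma downUpTwist_C (c : R) : downUpTwist α β γ (C c) = C c :=
  (downUpTwist α β γ).commutes c

@[simp] lemma downUpTwist_symm_X_zero :
    (downUpTwist α β γ).symm (X 0) = (↑β⁻¹ : R) • (X 1 - α • X 0 - C γ) := by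
  simp [downUpTwist]

@[simp] lemma downUpTwist_symm_X_one : (downUpTwist α β γ).symm (X 1) = X 0 := by
  simp [downUpTwist]

lemma totalDegree_X_le {σ : Type*} (i : σ) : (X i : MvPolynomial σ R).totalDegree ≤ 1 :=
  (totalDegree_monomial_le _ _).trans (by simp)

lemma totalDegree_algHom_le {σ τ : Type*} (φ : MvPolynomial σ R →ₐ[R] MvPolynomial τ R)
    (hφ : ∀ i, (φ (X i)).totalDegree ≤ 1) (p : MvPolynomial σ R) :
    (φ p).totalDegree ≤ p.totalDegree := by
  conv_lhs => rw [p.as_sum, map_sum]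
  refine totalDegree_finsetSum_le fun m hm => ?_
  calc (φ (monomial m (p.coeff m))).totalDegree
      = (p.coeff m • ∏ i ∈ m.support, φ (X i) ^ m i).totalDegree := by
        rw [monomial_eq, ← smul_eq_C_mul, map_smul, Finsupp.prod, map_prod]
        simp only [map_pow]
    _ ≤ ∑ i ∈ m.support, (φ (X i) ^ m i).totalDegree :=
        (totalDegree_smul_le _ _).trans (totalDegree_finsetProd _ _)
    _ ≤ ∑ i ∈ m.support, m i := Finset.sum_le_sum fun i _ =>
        (totalDegree_pow _ _).trans ((Nat.mul_le_mul_left _ (hφ i)).trans (mul_one _).le)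
    _ ≤ p.totalDegree := le_totalDegree hm

lemma totalDegree_downUpTwist_le (p : MvPolynomial (Fin 2) R) :
    (downUpTwist α β γ p).totalDegree ≤ p.totalDegree := by
  refine totalDegree_algHom_le (downUpTwist α β γ).toAlgHom (Fin.forall_fin_two.mpr ⟨?_, ?_⟩) p
  · simpa using totalDegree_X_le 1
  · rw [AlgEquiv.toAlgHom_apply, downUpTwist_X_one]
    refine (totalDegree_add _ _).trans (max_le ((totalDegree_add _ _).trans (max_le ?_ ?_)) ?_)
    · exact (totalDegree_smul_le _ _).trans (totalDegree_X_le 1)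
    · exact (totalDegree_smul_le _ _).trans (totalDegree_X_le 0)
    · simp

lemma totalDegree_downUpTwist_symm_le (p : MvPolynomial (Fin 2) R) :
    ((downUpTwist α β γ).symm p).totalDegree ≤ p.totalDegree := by
  refine totalDegree_algHom_le (downUpTwist α β γ).symm.toAlgHom
    (Fin.forall_fin_two.mpr ⟨?_, ?_⟩) p
  · rw [AlgEquiv.toAlgHom_apply, downUpTwist_symm_X_zero]
    refine (totalDegree_smul_le _ _).trans ((totalDegree_sub _ _).trans
      (max_le ((totalDegree_sub _ _).trans (max_le (totalDegree_X_le 1) ?_)) (by simp)))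
    exact (totalDegree_smul_le _ _).trans (totalDegree_X_le 0)
  · simpa using totalDegree_X_le 0

end Twist

namespace IsDownUpPair

open MvPolynomial

variable {R S : Type*} [CommRing R] [Ring S] [Algebra R S] {α β γ : R} {d u : S}

lemma op (h : IsDownUpPair α β γ d u) :
    IsDownUpPair α β γ (MulOpposite.op u) (MulOpposite.op d) where
  ddu := by simpa [mul_assoc] using congrArg MulOpposite.op h.duu
  duu := by simpa [mul_assoc] using congrArg MulOpposite.op h.ddu

lemma map {T : Type*} [Ring T] [Algebra R T] (h : IsDownUpPair α β γ d u) (φ : S →ₐ[R] T) :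
    IsDownUpPair α β γ (φ d) (φ u) where
  ddu := by simpa using congrArg φ h.ddu
  duu := by simpa using congrArg φ h.duu

lemma commute (h : IsDownUpPair α β γ d u) : Commute (u * d) (d * u) :=
  calc u * d * (d * u) = u * (d ^ 2 * u) := by noncomm_ring
    _ = d * u ^ 2 * d := by
      rw [h.ddu, h.duu]
      simp only [mul_add, add_mul, mul_smul_comm, smul_mul_assoc, pow_two, mul_assoc]
    _ = d * u * (u * d) := by noncomm_ring

lemma exists_polyHom (h : IsDownUpPair α β γ d u) : ∃ φ : MvPolynomial (Fin 2) R →ₐ[R] S,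
    φ (X 0) = u * d ∧ φ (X 1) = d * u := by
  have pairwise_commute : ∀ a ∈ ({u * d, d * u} : Set S), ∀ b ∈ ({u * d, d * u} : Set S),
      a * b = b * a := by
    rintro a (rfl | rfl) b (rfl | rfl)
    exacts [rfl, h.commute, h.commute.symm, rfl]
  have := Algebra.isMulCommutative_adjoin R pairwise_commute
  open scoped IsMulCommutative in
  let x : Algebra.adjoin R {u * d, d * u} := ⟨u * d, Algebra.subset_adjoin (Or.inl rfl)⟩
  let y : Algebra.adjoin R {u * d, d * u} := ⟨d * u, Algebra.subset_adjoin (Or.inr rfl)⟩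
  exact ⟨(Subalgebra.val _).comp (aeval ![x, y]), by simp [x], by simp [y]⟩

/-- The homomorphism from the polynomial ring in two variables with `X₀ ↦ u d`, `X₁ ↦ d u`. -/
noncomputable def polyHom (h : IsDownUpPair α β γ d u) : MvPolynomial (Fin 2) R →ₐ[R] S :=
  h.exists_polyHom.choose

@[simp] lemma polyHom_X_zero (h : IsDownUpPair α β γ d u) : h.polyHom (X 0) = u * d :=
  h.exists_polyHom.choose_spec.1

@[simp] lemma polyHom_X_one (h : IsDownUpPair α β γ d u) : h.polyHom (X 1) = d * u :=
  h.exists_polyHom.choose_spec.2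

@[simp] lemma polyHom_C (h : IsDownUpPair α β γ d u) (c : R) :
    h.polyHom (C c) = algebraMap R S c :=
  h.polyHom.commutes c

variable {b : Rˣ}

lemma d_mul_polyHom (h : IsDownUpPair α b γ d u) (p : MvPolynomial (Fin 2) R) :
    d * h.polyHom p = h.polyHom (downUpTwist α b γ p) * d := by
  induction p using MvPolynomial.induction_on with
  | C c => simpa using (Algebra.commutes c d).symm
  | add p q hp hq => simp only [map_add, mul_add, add_mul, hp, hq]
  | mul_X p i hp =>
    have twist_X : d * h.polyHom (X i) = h.polyHom (downUpTwist α b γ (X i)) * d := by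
      fin_cases i
      · simp [mul_assoc]
      · calc d * h.polyHom (X 1) = d ^ 2 * u := by rw [polyHom_X_one, ← mul_assoc, ← pow_two]
          _ = h.polyHom (downUpTwist α b γ (X 1)) * d := by
            rw [h.ddu]
            simp [add_mul, Algebra.smul_def, pow_two, mul_assoc]
    rw [map_mul, ← mul_assoc, hp, map_mul, map_mul, mul_assoc, mul_assoc, twist_X]

lemma u_mul_polyHom_downUpTwist (h : IsDownUpPair α b γ d u) (p : MvPolynomial (Fin 2) R) :
    u * h.polyHom (downUpTwist α b γ p) = h.polyHom p * u := by
  induction p using MvPolynomial.induction_on with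
  | C c => simpa using (Algebra.commutes c u).symm
  | add p q hp hq => simp only [map_add, mul_add, add_mul, hp, hq]
  | mul_X p i hp =>
    have twist_X : u * h.polyHom (downUpTwist α b γ (X i)) = h.polyHom (X i) * u := by
      fin_cases i
      · simp [mul_assoc]
      · calc u * h.polyHom (downUpTwist α b γ (X 1)) = d * u ^ 2 := by
              rw [h.duu]
              simp [mul_add, pow_two, mul_assoc, Algebra.smul_def,
                Algebra.commutes]
          _ = h.polyHom (X 1) * u := by rw [polyHom_X_one, mul_assoc, ← pow_two]
    rw [map_mul, map_mul, ← mul_assoc, hp, map_mul, mul_assoc, mul_assoc, twist_X]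

lemma polyHom_mul_d (h : IsDownUpPair α b γ d u) (p : MvPolynomial (Fin 2) R) :
    h.polyHom p * d = d * h.polyHom ((downUpTwist α b γ).symm p) := by
  rw [h.d_mul_polyHom, AlgEquiv.apply_symm_apply]

lemma u_mul_polyHom (h : IsDownUpPair α b γ d u) (p : MvPolynomial (Fin 2) R) :
    u * h.polyHom p = h.polyHom ((downUpTwist α b γ).symm p) * u := by
  rw [← h.u_mul_polyHom_downUpTwist, AlgEquiv.apply_symm_apply]

lemma closure_insert_range_polyHom (h : IsDownUpPair α β γ d u)
    (hgen : Algebra.adjoin R {d, u} = ⊤) :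
    Subring.closure (insert d (insert u (Set.range h.polyHom))) = ⊤ := by
  rw [eq_top_iff, ← Algebra.top_toSubring (R := R), ← hgen, Algebra.adjoin_eq_ring_closure]
  refine Subring.closure_mono ?_
  rintro _ (⟨c, rfl⟩ | rfl | rfl)
  · exact Or.inr (Or.inr ⟨C c, h.polyHom_C c⟩)
  · exact Or.inl rfl
  · exact Or.inr (Or.inl rfl)

lemma isNoetherianRing [IsNoetherianRing R] (h : IsDownUpPair α b γ d u)
    (hgen : Algebra.adjoin R {d, u} = ⊤) : IsNoetherianRing S := by
  have mem_closure {s : Set S} (hs : Set.range h.polyHom ⊆ s) (p : MvPolynomial (Fin 2) R) :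
      h.polyHom p ∈ Subring.closure s := Subring.subset_closure (hs ⟨p, rfl⟩)
  have noetherian_poly : IsNoetherianRing (Subring.closure (Set.range h.polyHom)) := by
    rw [← AlgHom.coe_toRingHom, ← RingHom.coe_range, Subring.closure_eq]
    exact isNoetherianRing_range _
  have noetherian_poly_u :
      IsNoetherianRing (Subring.closure (insert u (Set.range h.polyHom))) := by
    refine isNoetherianRing_closure_insert ?_ ?_ <;> rintro _ ⟨p, rfl⟩
    · exact ⟨_, mem_closure le_rfl _, 0, zero_mem _, by rw [h.u_mul_polyHom, add_zero]⟩
    · exact ⟨_, mem_closure le_rfl _, 0, zero_mem _,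
        by rw [← h.u_mul_polyHom_downUpTwist, add_zero]⟩
  have noetherian_poly_u_d :
      IsNoetherianRing (Subring.closure (insert d (insert u (Set.range h.polyHom)))) := by
    have hs := Set.subset_insert u (Set.range h.polyHom)
    refine isNoetherianRing_closure_insert ?_ ?_ <;> rintro _ (rfl | ⟨p, rfl⟩)
    · exact ⟨0, zero_mem _, _, mem_closure hs (X 1), by simp⟩
    · exact ⟨_, mem_closure hs _, 0, zero_mem _, by rw [h.d_mul_polyHom, add_zero]⟩
    · exact ⟨0, zero_mem _, _, mem_closure hs (X 0), by simp⟩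
    · exact ⟨_, mem_closure hs _, 0, zero_mem _, by rw [h.polyHom_mul_d, add_zero]⟩
  rw [h.closure_insert_range_polyHom hgen] at noetherian_poly_u_d
  exact isNoetherianRing_of_ringEquiv _ Subring.topEquiv

theorem isLeftRightNoetherian [IsNoetherianRing R] (h : IsDownUpPair α b γ d u)
    (hgen : Algebra.adjoin R {d, u} = ⊤) : IsLeftRightNoetherian S := by
  refine ⟨h.isNoetherianRing hgen, h.op.isNoetherianRing ?_⟩
  have generators_op :
      ({MulOpposite.op u, MulOpposite.op d} : Set Sᵐᵒᵖ) = MulOpposite.unop ⁻¹' {d, u} := by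
    ext z
    simp [or_comm, ← MulOpposite.unop_inj (x := z)]
  rw [generators_op, ← Subalgebra.op_adjoin, hgen]
  rfl

end IsDownUpPair

/-! ### Standard monomials -/

/-- The exponents `(k, m)` of the standard monomials `(u d) ^ m₀ * (d u) ^ m₁ * t_k`, where
`t_k = d ^ k` for `k ≥ 0` and `t_k = u ^ (-k)` for `k ≤ 0`. -/
abbrev DownUpExp : Type := ℤ × (Fin 2 →₀ ℕ)

namespace DownUpExp

/-- The degree of a standard monomial as a word in `d` and `u`. -/
noncomputable def deg (i : DownUpExp) : ℕ := 2 * i.2.degree + i.1.natAbs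

lemma deg_eq (i : DownUpExp) : i.deg = 2 * i.2 0 + 2 * i.2 1 + i.1.natAbs := by
  rw [deg, Finsupp.degree_eq_sum, Fin.sum_univ_two, mul_add]

lemma finite_deg_le (n : ℕ) : {i : DownUpExp | i.deg ≤ n}.Finite := by
  refine ((Set.finite_Icc (-(n : ℤ)) n).prod (Finsupp.finite_of_degree_le n)).subset ?_
  rintro ⟨k, m⟩ (h : 2 * m.degree + k.natAbs ≤ n)
  exact ⟨⟨by lia, by lia⟩, show m.degree ≤ n by lia⟩

variable {S : Type*} [Ring S] (d u : S)

/-- The element `t_k`, which is `d ^ k` for `k ≥ 0` and `u ^ (-k)` for `k ≤ 0`. It is encoded as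
`d ^ k⁺ * u ^ k⁻`, where one of the two exponents vanishes. -/
def tpow (k : ℤ) : S := d ^ k.toNat * u ^ (-k).toNat

/-- The standard monomial `(u d) ^ m₀ * (d u) ^ m₁ * t_k`. -/
def monom (i : DownUpExp) : S := (u * d) ^ i.2 0 * (d * u) ^ i.2 1 * tpow d u i.1

@[simp] lemma tpow_zero : tpow d u 0 = 1 := by
  simp [tpow]

@[simp] lemma tpow_natCast (n : ℕ) : tpow d u n = d ^ n := by
  simp [tpow]

@[simp] lemma tpow_neg_natCast (n : ℕ) : tpow d u (-n) = u ^ n := by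
  simp [tpow]

lemma map_monom {T : Type*} [Ring T] (f : S →+* T) (i : DownUpExp) :
    f (monom d u i) = monom (f d) (f u) i := by
  simp [monom, tpow]

variable {d u}

lemma monom_mem_pow {R : Type*} [CommRing R] [Algebra R S] {E : Submodule R S} (hE : 1 ≤ E)
    (hd : d ∈ E) (hu : u ∈ E) {i : DownUpExp} {n : ℕ} (hi : i.deg ≤ n) : monom d u i ∈ E ^ n := by
  refine pow_le_pow_right₀ hE hi ?_
  have tpow_mem : tpow d u i.1 ∈ E ^ i.1.natAbs := by
    rw [← Int.toNat_add_toNat_neg_eq_natAbs, pow_add]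
    exact Submodule.mul_mem_mul (Submodule.pow_mem_pow _ hd _) (Submodule.pow_mem_pow _ hu _)
  rw [deg_eq, pow_add, pow_add, pow_mul, pow_mul, pow_two]
  exact Submodule.mul_mem_mul (Submodule.mul_mem_mul
    (Submodule.pow_mem_pow _ (Submodule.mul_mem_mul hu hd) _)
    (Submodule.pow_mem_pow _ (Submodule.mul_mem_mul hd hu) _)) tpow_mem

end DownUpExp

namespace IsDownUpPair

open DownUpExp MvPolynomial

variable {R S : Type*} [CommRing R] [Ring S] [Algebra R S] {α β γ : R} {b : Rˣ} {d u : S}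

lemma polyHom_monomial_mul_tpow (h : IsDownUpPair α β γ d u) (i : DownUpExp) :
    h.polyHom (monomial i.2 1) * tpow d u i.1 = monom d u i := by
  simp [monom, monomial_eq, Finsupp.prod_fintype, Fin.prod_univ_two]

lemma polyHom_mul_tpow_mem (h : IsDownUpPair α β γ d u) (p : MvPolynomial (Fin 2) R) {k : ℤ}
    {n : ℕ} (hn : 2 * p.totalDegree + k.natAbs ≤ n) :
    h.polyHom p * tpow d u k ∈ Submodule.span R (monom d u '' {i | i.deg ≤ n}) := by
  have sum_eq : h.polyHom p * tpow d u k =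
      ∑ m ∈ p.support, h.polyHom (monomial m (p.coeff m)) * tpow d u k := by
    conv_lhs => rw [p.as_sum, map_sum, Finset.sum_mul]
  rw [sum_eq]
  refine sum_mem fun m hm => ?_
  rw [show monomial m (p.coeff m) = p.coeff m • monomial m 1 by
    rw [smul_monomial, smul_eq_mul, mul_one], map_smul, smul_mul_assoc,
    h.polyHom_monomial_mul_tpow (k, m)]
  refine Submodule.smul_mem _ _ (Submodule.subset_span ⟨(k, m), ?_, rfl⟩)
  have degree_le : m.degree ≤ p.totalDegree := le_totalDegree hm
  change 2 * m.degree + k.natAbs ≤ n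
  lia

lemma exists_d_mul_tpow_eq (h : IsDownUpPair α β γ d u) (k : ℤ) :
    ∃ q, 2 * q.totalDegree + (k + 1).natAbs ≤ k.natAbs + 1 ∧
      d * tpow d u k = h.polyHom q * tpow d u (k + 1) := by
  obtain ⟨n, rfl⟩ | ⟨n, rfl⟩ : (∃ n : ℕ, k = n) ∨ ∃ n : ℕ, k = -(n + 1 : ℕ) := by
    rcases lt_or_ge k 0 with hk | hk
    exacts [.inr ⟨(-k - 1).toNat, by lia⟩, .inl ⟨k.toNat, by lia⟩]
  · refine ⟨1, by rw [totalDegree_one]; lia, ?_⟩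
    rw [← Nat.cast_succ, tpow_natCast, tpow_natCast, map_one, one_mul, pow_succ']
  · have hX := totalDegree_X_le (R := R) (1 : Fin 2)
    refine ⟨X 1, by lia, ?_⟩
    rw [show -((n + 1 : ℕ) : ℤ) + 1 = -(n : ℕ) by lia, tpow_neg_natCast, tpow_neg_natCast,
      polyHom_X_one, mul_assoc, pow_succ']

lemma exists_u_mul_tpow_eq (h : IsDownUpPair α β γ d u) (k : ℤ) :
    ∃ q, 2 * q.totalDegree + (k - 1).natAbs ≤ k.natAbs + 1 ∧
      u * tpow d u k = h.polyHom q * tpow d u (k - 1) := by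
  obtain ⟨n, rfl⟩ | ⟨n, rfl⟩ : (∃ n : ℕ, k = -n) ∨ ∃ n : ℕ, k = (n + 1 : ℕ) := by
    rcases lt_or_ge 0 k with hk | hk
    exacts [.inr ⟨(k - 1).toNat, by lia⟩, .inl ⟨(-k).toNat, by lia⟩]
  · refine ⟨1, by rw [totalDegree_one]; lia, ?_⟩
    rw [show -(n : ℤ) - 1 = -(n + 1 : ℕ) by lia, tpow_neg_natCast, tpow_neg_natCast, map_one,
      one_mul, pow_succ']
  · have hX := totalDegree_X_le (R := R) (0 : Fin 2)
    refine ⟨X 0, by lia, ?_⟩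
    rw [show ((n + 1 : ℕ) : ℤ) - 1 = (n : ℕ) by lia, tpow_natCast, tpow_natCast,
      polyHom_X_zero, mul_assoc, pow_succ']

lemma d_mul_monom_mem (h : IsDownUpPair α b γ d u) {n : ℕ} {i : DownUpExp} (hi : i.deg ≤ n) :
    d * monom d u i ∈ Submodule.span R (monom d u '' {i | i.deg ≤ n + 1}) := by
  obtain ⟨q, hq, hdq⟩ := h.exists_d_mul_tpow_eq i.1
  rw [← h.polyHom_monomial_mul_tpow, ← mul_assoc, h.d_mul_polyHom, mul_assoc, hdq, ← mul_assoc,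
    ← map_mul]
  refine h.polyHom_mul_tpow_mem _ ?_
  have degree_mul := totalDegree_mul (downUpTwist α b γ (monomial i.2 1)) q
  have degree_twist := totalDegree_downUpTwist_le α b γ (monomial i.2 1)
  have degree_monomial : (monomial i.2 (1 : R)).totalDegree ≤ i.2.degree :=
    totalDegree_monomial_le _ _
  rw [deg] at hi
  lia

lemma u_mul_monom_mem (h : IsDownUpPair α b γ d u) {n : ℕ} {i : DownUpExp} (hi : i.deg ≤ n) :
    u * monom d u i ∈ Submodule.span R (monom d u '' {i | i.deg ≤ n + 1}) := by
  obtain ⟨q, hq, huq⟩ := h.exists_u_mul_tpow_eq i.1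
  rw [← h.polyHom_monomial_mul_tpow, ← mul_assoc, h.u_mul_polyHom, mul_assoc, huq, ← mul_assoc,
    ← map_mul]
  refine h.polyHom_mul_tpow_mem _ ?_
  have degree_mul := totalDegree_mul ((downUpTwist α b γ).symm (monomial i.2 1)) q
  have degree_twist := totalDegree_downUpTwist_symm_le α b γ (monomial i.2 1)
  have degree_monomial : (monomial i.2 (1 : R)).totalDegree ≤ i.2.degree :=
    totalDegree_monomial_le _ _
  rw [deg] at hi
  lia

theorem span_pow_eq_span_monom (h : IsDownUpPair α b γ d u) (n : ℕ) :
    Submodule.span R (insert 1 {d, u}) ^ n = Submodule.span R (monom d u '' {i | i.deg ≤ n}) := by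
  refine le_antisymm ?_ (Submodule.span_le.mpr ?_)
  · induction n with
    | zero =>
      rw [pow_zero, Submodule.one_le]
      exact Submodule.subset_span ⟨0, by simp [deg], by simp [monom]⟩
    | succ n ih =>
      rw [pow_succ']
      refine (mul_le_mul' le_rfl ih).trans ?_
      rw [Submodule.span_mul_span, Submodule.span_le]
      rintro _ ⟨e, he, _, ⟨i, hi, rfl⟩, rfl⟩
      rcases he with rfl | rfl | rfl
      · exact Submodule.subset_span ⟨i, Nat.le_succ_of_le hi, (one_mul _).symm⟩
      · exact h.d_mul_monom_mem hi
      · exact h.u_mul_monom_mem hi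
  · rintro _ ⟨i, hi, rfl⟩
    exact monom_mem_pow
      (Submodule.one_le.mpr (Submodule.subset_span (Set.mem_insert _ _)))
      (Submodule.subset_span (by simp)) (Submodule.subset_span (by simp)) hi

theorem span_range_monom_eq_top (h : IsDownUpPair α b γ d u)
    (hgen : Algebra.adjoin R {d, u} = ⊤) : Submodule.span R (Set.range (monom d u)) = ⊤ := by
  refine eq_top_iff.mpr fun a _ => ?_
  obtain ⟨n, hn : a ∈ Submodule.span R (insert 1 {d, u}) ^ n⟩ :=
    (NFiltration.ofGenerators {d, u} hgen).exhaustive' a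
  rw [h.span_pow_eq_span_monom] at hn
  exact Submodule.span_mono (Set.image_subset_range _ _) hn

end IsDownUpPair

/-! ### Polynomial identities -/

section StandardIdentity

/-- The standard polynomial `∑ sign(π) x_{π 0} ⋯ x_{π (n - 1)}`. -/
def standardPoly (K : Type*) [CommRing K] (n : ℕ) : FreeAlgebra K ℕ :=
  ∑ π : Equiv.Perm (Fin n), (Equiv.Perm.sign π : ℤ) •
    (List.ofFn fun i => FreeAlgebra.ι K (π i : ℕ)).prod

lemma prod_map_ι_eq_basisFreeMonoid (K : Type*) {X : Type*} [CommRing K] (l : List X) :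
    (l.map (FreeAlgebra.ι K)).prod = FreeAlgebra.basisFreeMonoid K X (FreeMonoid.ofList l) := by
  simp [FreeAlgebra.basisFreeMonoid, FreeAlgebra.equivMonoidAlgebraFreeMonoid,
    FreeMonoid.lift_apply]

lemma standardPoly_ne_zero (K : Type*) [CommRing K] [Nontrivial K] (n : ℕ) :
    standardPoly K n ≠ 0 := by
  classical
  let word (π : Equiv.Perm (Fin n)) : FreeMonoid ℕ :=
    FreeMonoid.ofList (List.ofFn fun i => (π i : ℕ))
  have word_injective : Function.Injective word := fun π ρ h => Equiv.ext fun i =>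
    Fin.ext (congrFun (List.ofFn_injective (FreeMonoid.ofList.injective h)) i)
  have standardPoly_eq : standardPoly K n = ∑ π : Equiv.Perm (Fin n),
      (Equiv.Perm.sign π : ℤ) • FreeAlgebra.basisFreeMonoid K ℕ (word π) := by
    simp only [word, ← prod_map_ι_eq_basisFreeMonoid, List.map_ofFn]
    rfl
  intro h
  have coeff_eq := congrArg (fun p => (FreeAlgebra.basisFreeMonoid K ℕ).repr p (word 1)) h
  simp only [standardPoly_eq, map_sum, map_zsmul, Module.Basis.repr_self, Finsupp.finsetSum_apply,
    Finsupp.smul_apply, Finsupp.single_apply, word_injective.eq_iff] at coeff_eq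
  simp at coeff_eq

lemma lift_standardPoly {K S : Type*} [CommRing K] [Ring S] [Algebra K S] (Z : Type*) [CommRing Z]
    [Algebra Z S] (n : ℕ) (x : ℕ → S) : FreeAlgebra.lift K x (standardPoly K n) =
      (MultilinearMap.mkPiAlgebraFin Z n S).alternatization fun i => x i := by
  simp [standardPoly, MultilinearMap.alternatization_apply, map_list_prod, List.map_ofFn,
    Function.comp_def, Units.smul_def, -List.ofFn_succ]

lemma alternatingMap_eq_zero_of_span_eq_top {Z M N : Type*} [CommRing Z] [AddCommGroup M]
    [Module Z M] [AddCommGroup N] [Module Z N] {n m : ℕ} {g : Fin n → M}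
    (hg : Submodule.span Z (Set.range g) = ⊤) (hnm : n < m) (A : M [⋀^Fin m]→ₗ[Z] N) : A = 0 := by
  let p : (Fin n → Z) →ₗ[Z] M := Fintype.linearCombination _ g
  have hp : Function.Surjective p := by
    rw [← LinearMap.range_eq_top, Fintype.range_linearCombination, hg]
  have comp_eq_zero : A.compLinearMap p = 0 := by
    refine Module.Basis.ext_alternating (Pi.basisFun _ (Fin n)) fun v hv => ?_
    have := Fintype.card_le_of_injective v hv
    simp at this
    lia
  ext x
  choose y hy using fun i => hp (x i)
  simpa [hy] using DFunLike.congr_fun comp_eq_zero y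

theorem isPIAlgebra_of_finite {K S : Type*} [CommRing K] [Nontrivial K] [Ring S] [Algebra K S]
    (Z : Type*) [CommRing Z] [Algebra Z S] [Module.Finite Z S] : IsPIAlgebra K S := by
  obtain ⟨n, g, hg⟩ := Module.Finite.exists_fin (R := Z) (M := S)
  refine ⟨standardPoly K (n + 1), standardPoly_ne_zero K _, fun x => ?_⟩
  rw [lift_standardPoly Z, alternatingMap_eq_zero_of_span_eq_top hg n.lt_succ_self
    (MultilinearMap.alternatization _), AlternatingMap.zero_apply]

end StandardIdentity

/-! ### Finiteness over the center -/

section FiniteTwist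

open MvPolynomial

lemma isOfFinOrder_downUpTwist {R : Type*} [CommRing R] [Finite R] (α : R) (β : Rˣ) (γ : R) :
    IsOfFinOrder (downUpTwist α β γ) := by
  have degree_le (n : ℕ) (i : Fin 2) : ((downUpTwist α β γ ^ n) (X i)).totalDegree ≤ 1 := by
    induction n with
    | zero => exact totalDegree_X_le i
    | succ n ih =>
      rw [pow_succ']
      exact (totalDegree_downUpTwist_le α β γ _).trans ih
  have finite_linear : Finite (restrictTotalDegree (Fin 2) R 1) := Module.finite_of_finite R
  let images (n : ℕ) (i : Fin 2) : restrictTotalDegree (Fin 2) R 1 :=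
    ⟨(downUpTwist α β γ ^ n) (X i), (mem_restrictTotalDegree _ _ _).mpr (degree_le n i)⟩
  obtain ⟨m, n, hmn, h_eq⟩ := Finite.exists_ne_map_eq_of_infinite images
  have pow_eq : downUpTwist α β γ ^ m = downUpTwist α β γ ^ n :=
    AlgEquiv.coe_toAlgHom_injective
      (algHom_ext fun i => congrArg Subtype.val (congrFun h_eq i))
  by_contra h_inf
  exact hmn (injective_pow_iff_not_isOfFinOrder.mpr h_inf pow_eq)

lemma isIntegral_fixedPoints_zpowers {R P : Type*} [CommRing R] [CommRing P] [Algebra R P]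
    {σ : P ≃ₐ[R] P} (hσ : IsOfFinOrder σ) (p : P) :
    IsIntegral (FixedPoints.subring P (Subgroup.zpowers σ)) p := by
  have : Finite (Subgroup.zpowers σ) := finite_zpowers.mpr hσ
  have : Algebra.IsInvariant (FixedPoints.subring P (Subgroup.zpowers σ)) P
      (Subgroup.zpowers σ) := ⟨fun p hp => ⟨⟨p, hp⟩, rfl⟩⟩
  exact (Algebra.IsInvariant.isIntegral _ P (Subgroup.zpowers σ)).isIntegral p

end FiniteTwist

lemma mem_center_of_adjoin_eq_top {R S : Type*} [CommRing R] [Ring S] [Algebra R S] {s : Set S}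
    (hs : Algebra.adjoin R s = ⊤) {z : S} (hz : ∀ a ∈ s, Commute z a) : z ∈ Subring.center S := by
  have adjoin_le : Algebra.adjoin R s ≤ Subalgebra.centralizer R {z} :=
    Algebra.adjoin_le fun a ha => (Subalgebra.mem_centralizer_iff R).mpr fun _ hz' =>
      Set.eq_of_mem_singleton hz' ▸ hz a ha
  rw [hs] at adjoin_le
  exact Subring.mem_center_iff.mpr fun a =>
    ((Subalgebra.mem_centralizer_iff R).mp (adjoin_le (Algebra.mem_top (x := a))) z rfl).symm

namespace IsDownUpPair

open MvPolynomial DownUpExp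

variable {R S : Type*} [CommRing R] [Ring S] [Algebra R S] {α γ : R} {b : Rˣ} {d u : S}

lemma d_pow_mul_polyHom (h : IsDownUpPair α b γ d u) (n : ℕ) (p : MvPolynomial (Fin 2) R) :
    d ^ n * h.polyHom p = h.polyHom ((downUpTwist α b γ ^ n) p) * d ^ n := by
  induction n generalizing p with
  | zero => simp
  | succ n ih =>
    rw [pow_succ, mul_assoc, h.d_mul_polyHom, ← mul_assoc, ih, pow_succ (downUpTwist α b γ),
      AlgEquiv.mul_apply, mul_assoc]

lemma u_pow_mul_polyHom (h : IsDownUpPair α b γ d u) (n : ℕ) (p : MvPolynomial (Fin 2) R) :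
    u ^ n * h.polyHom ((downUpTwist α b γ ^ n) p) = h.polyHom p * u ^ n := by
  induction n generalizing p with
  | zero => simp
  | succ n ih =>
    rw [pow_succ, mul_assoc, pow_succ', AlgEquiv.mul_apply, h.u_mul_polyHom_downUpTwist,
      ← mul_assoc, ih, mul_assoc]

variable (h : IsDownUpPair α b γ d u) (hgen : Algebra.adjoin R {d, u} = ⊤)

include h hgen

lemma d_pow_mem_center {n : ℕ} (hσ : downUpTwist α b γ ^ (n + 1) = 1) :
    d ^ (n + 1) ∈ Subring.center S := by
  refine mem_center_of_adjoin_eq_top hgen ?_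
  rintro _ (rfl | rfl)
  · exact Commute.pow_self _ _
  calc d ^ (n + 1) * _ = d ^ n * h.polyHom (downUpTwist α b γ (X 0)) := by
        rw [downUpTwist_X_zero, polyHom_X_one, pow_succ, mul_assoc]
    _ = h.polyHom (X 0) * d ^ n := by
        rw [h.d_pow_mul_polyHom, ← AlgEquiv.mul_apply, ← pow_succ, hσ, AlgEquiv.one_apply]
    _ = _ * d ^ (n + 1) := by rw [polyHom_X_zero, mul_assoc, ← pow_succ']

lemma u_pow_mem_center {n : ℕ} (hσ : downUpTwist α b γ ^ (n + 1) = 1) :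
    u ^ (n + 1) ∈ Subring.center S := by
  refine mem_center_of_adjoin_eq_top hgen ?_
  rintro _ (rfl | rfl)
  · calc u ^ (n + 1) * _ = u ^ n * h.polyHom ((downUpTwist α b γ ^ (n + 1)) (X 0)) := by
          rw [hσ, AlgEquiv.one_apply, polyHom_X_zero, pow_succ, mul_assoc]
      _ = h.polyHom (X 1) * u ^ n := by
          rw [pow_succ, AlgEquiv.mul_apply, h.u_pow_mul_polyHom, downUpTwist_X_zero]
      _ = _ * u ^ (n + 1) := by rw [polyHom_X_one, mul_assoc, ← pow_succ']
  · exact Commute.pow_self _ _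

lemma polyHom_mem_center {p : MvPolynomial (Fin 2) R} (hp : downUpTwist α b γ p = p) :
    h.polyHom p ∈ Subring.center S := by
  refine mem_center_of_adjoin_eq_top hgen ?_
  rintro _ (rfl | rfl)
  · simpa [hp, commute_iff_eq] using (h.d_mul_polyHom p).symm
  · simpa [hp, commute_iff_eq] using (h.u_mul_polyHom_downUpTwist p).symm

lemma isIntegral_polyHom (hσ : IsOfFinOrder (downUpTwist α b γ)) (p : MvPolynomial (Fin 2) R) :
    IsIntegral (Subring.center S) (h.polyHom p) := by
  let toCenter : FixedPoints.subring (MvPolynomial (Fin 2) R)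
      (Subgroup.zpowers (downUpTwist α b γ)) →+* Subring.center S :=
    (h.polyHom.toRingHom.comp (Subring.subtype _)).codRestrict _ fun p =>
      h.polyHom_mem_center hgen (p.2 ⟨_, Subgroup.mem_zpowers _⟩)
  exact (isIntegral_fixedPoints_zpowers hσ p).map_of_comp_eq toCenter h.polyHom.toRingHom rfl

theorem finite_center (hσ : IsOfFinOrder (downUpTwist α b γ)) :
    Module.Finite (Subring.center S) S := by
  let Z := Subring.center S
  have integral_of_pow {a : S} {n : ℕ} (ha : a ^ (n + 1) ∈ Z) : IsIntegral Z a :=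
    IsIntegral.of_pow n.succ_pos (isIntegral_algebraMap (x := (⟨_, ha⟩ : Z)))
  obtain ⟨n, hn, h_one⟩ := hσ.exists_pow_eq_one
  obtain ⟨n, rfl⟩ := Nat.exists_eq_add_one_of_ne_zero hn.ne'
  have integral_d := integral_of_pow (h.d_pow_mem_center hgen h_one)
  have integral_u := integral_of_pow (h.u_pow_mem_center hgen h_one)
  have integral_ud : IsIntegral Z (u * d) := by simpa using h.isIntegral_polyHom hgen hσ (X 0)
  have integral_du : IsIntegral Z (d * u) := by simpa using h.isIntegral_polyHom hgen hσ (X 1)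
  let powers (a : S) : Submodule Z S := Subalgebra.toSubmodule (Algebra.adjoin Z {a})
  have pow_mem (a : S) (k : ℕ) : a ^ k ∈ powers a :=
    Subalgebra.pow_mem _ (Algebra.self_mem_adjoin_singleton _ a) k
  let M : Submodule Z S := powers (u * d) * powers (d * u) * (powers d * powers u)
  have M_fg : M.FG := (integral_ud.fg_adjoin_singleton.mul integral_du.fg_adjoin_singleton).mul
    (integral_d.fg_adjoin_singleton.mul integral_u.fg_adjoin_singleton)
  have monom_mem (i : DownUpExp) : monom d u i ∈ M := Submodule.mul_mem_mul
    (Submodule.mul_mem_mul (pow_mem _ _) (pow_mem _ _))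
    (Submodule.mul_mem_mul (pow_mem _ _) (pow_mem _ _))
  have mem_M (a : S) : a ∈ M := by
    have ha : a ∈ Submodule.span R (Set.range (monom d u)) := by
      rw [h.span_range_monom_eq_top hgen]
      trivial
    induction ha using Submodule.span_induction with
    | mem a ha => exact ha.choose_spec ▸ monom_mem _
    | zero => exact zero_mem M
    | add a a' _ _ ha ha' => exact add_mem ha ha'
    | smul c a _ ha =>
      rw [Algebra.smul_def]
      exact M.smul_mem (⟨_, Subring.mem_center_iff.mpr fun g => (Algebra.commutes c g).symm⟩ : Z) ha
  exact ⟨(eq_top_iff.mpr fun a _ => mem_M a : M = ⊤) ▸ M_fg⟩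

theorem isPIAlgebra [Finite R] [Nontrivial R] : IsPIAlgebra R S :=
  have := h.finite_center hgen (isOfFinOrder_downUpTwist α b γ)
  isPIAlgebra_of_finite (Subring.center S)

end IsDownUpPair

/-! ### Linear independence of the standard monomials -/

namespace DownUpAlgebra

open MvPolynomial DownUpExp

lemma isDownUpPair {R : Type*} [CommRing R] (α β γ : R) :
    IsDownUpPair α β γ (d α β γ) (u α β γ) where
  ddu := by simpa [d, u] using RingQuot.mkAlgHom_rel R (DownUpRel.ddu (α := α) (β := β) (γ := γ))
  duu := by simpa [d, u] using RingQuot.mkAlgHom_rel R (DownUpRel.duu (α := α) (β := β) (γ := γ))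

lemma exists_algHom {R S : Type*} [CommRing R] [Ring S] [Algebra R S] {α β γ : R} {d' u' : S}
    (h : IsDownUpPair α β γ d' u') :
    ∃ ρ : DownUpAlgebra α β γ →ₐ[R] S, ρ (d α β γ) = d' ∧ ρ (u α β γ) = u' := by
  let freeHom : FreeAlgebra R DownUpGen →ₐ[R] S :=
    FreeAlgebra.lift R fun g => DownUpGen.casesOn g d' u'
  have rel_le : ∀ ⦃x y⦄, DownUpRel α β γ x y → freeHom x = freeHom y := by
    rintro x y (_ | _)
    · simpa [freeHom] using h.ddu
    · simpa [freeHom] using h.duu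
  exact ⟨RingQuot.liftAlgHom R ⟨freeHom, rel_le⟩, by simp [d, freeHom], by simp [u, freeHom]⟩

variable {R : Type*} [CommRing R] (α : R) (b : Rˣ) (γ : R)

/-- The polynomials `σ ^ n (X₀)`, where `σ` is the twist. They are the weights of the shift
representation of the down-up algebra. -/
noncomputable def weight (n : ℤ) : MvPolynomial (Fin 2) R := (downUpTwist α b γ ^ n) (X 0)

lemma weight_zero : weight α b γ 0 = X 0 := by simp [weight]

lemma weight_one : weight α b γ 1 = X 1 := by simp [weight]

lemma weight_add_two (n : ℤ) : weight α b γ (n + 2) =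
    α • weight α b γ (n + 1) + (b : R) • weight α b γ n + C γ := by
  have weight_succ : weight α b γ (n + 1) = (downUpTwist α b γ ^ n) (X 1) := by
    rw [weight, zpow_add, zpow_one, AlgEquiv.mul_apply, downUpTwist_X_zero]
  have weight_succ_succ : weight α b γ (n + 2) =
      (downUpTwist α b γ ^ n) (downUpTwist α b γ (X 1)) := by
    rw [weight, zpow_add, zpow_ofNat, pow_two, AlgEquiv.mul_apply, AlgEquiv.mul_apply,
      downUpTwist_X_zero]
  rw [weight_succ, weight_succ_succ, downUpTwist_X_one, map_add, map_add, map_smul, map_smul]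
  congr 1
  exact (downUpTwist α b γ ^ n).commutes γ

lemma weight_isRegular (n : ℤ) : IsRegular (weight α b γ n) := by
  refine isLeftRegular_iff_isRegular.mp fun p q hpq => ?_
  apply (downUpTwist α b γ ^ n).symm.injective
  apply (isRegular_X (R := R) (n := (0 : Fin 2))).left
  simpa [weight] using congrArg (downUpTwist α b γ ^ n).symm hpq

/-- The shift `(d f)(n) = f (n + 1)` on functions `ℤ → R[X₀, X₁]`. -/
noncomputable def shift (R : Type*) [CommRing R] :
    Module.End R (ℤ → MvPolynomial (Fin 2) R) :=
  LinearMap.funLeft R _ fun n : ℤ => n + 1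

/-- The weighted shift `(u f)(n) = σ ^ n (X₀) f (n - 1)` on functions `ℤ → R[X₀, X₁]`. -/
noncomputable def weightedShift : Module.End R (ℤ → MvPolynomial (Fin 2) R) where
  toFun f n := weight α b γ n * f (n - 1)
  map_add' f g := by
    ext1 n
    simp [mul_add]
  map_smul' c f := by
    ext1 n
    simp

@[simp] lemma shift_apply (f : ℤ → MvPolynomial (Fin 2) R) (n : ℤ) : shift R f n = f (n + 1) := rfl

@[simp] lemma weightedShift_apply (f : ℤ → MvPolynomial (Fin 2) R) (n : ℤ) :
    weightedShift α b γ f n = weight α b γ n * f (n - 1) := rfl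

lemma isDownUpPair_shift : IsDownUpPair α (b : R) γ (shift R) (weightedShift α b γ) where
  ddu := by
    ext1 f
    ext1 n
    have weight_eq := weight_add_two α b γ n
    simp only [pow_two, Module.End.mul_apply, LinearMap.add_apply, LinearMap.smul_apply,
      Pi.add_apply, Pi.smul_apply, shift_apply, weightedShift_apply, add_sub_cancel_right,
      sub_add_cancel, add_assoc, one_add_one_eq_two] at weight_eq ⊢
    rw [weight_eq, show n + 2 - 1 = n + 1 by ring]
    simp only [MvPolynomial.smul_eq_C_mul]
    ring
  duu := by
    ext1 f
    ext1 n
    have weight_eq := weight_add_two α b γ (n - 1)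
    rw [show n - 1 + 2 = n + 1 by ring, sub_add_cancel] at weight_eq
    simp only [pow_two, Module.End.mul_apply, LinearMap.add_apply, LinearMap.smul_apply,
      Pi.add_apply, Pi.smul_apply, shift_apply, weightedShift_apply, add_sub_cancel_right,
      sub_add_cancel, weight_eq]
    simp only [MvPolynomial.smul_eq_C_mul]
    ring

lemma polyHom_shift_apply_zero (p : MvPolynomial (Fin 2) R) (f : ℤ → MvPolynomial (Fin 2) R) :
    (isDownUpPair_shift α b γ).polyHom p f 0 = p * f 0 := by
  induction p using MvPolynomial.induction_on generalizing f with
  | C c => simp [smul_eq_C_mul]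
  | add p q hp hq => simp [hp, hq, add_mul]
  | mul_X p i hp =>
    rw [map_mul, Module.End.mul_apply, hp, mul_assoc]
    fin_cases i <;> simp [weight_zero, weight_one]

lemma shift_pow_apply (k : ℕ) (f : ℤ → MvPolynomial (Fin 2) R) (n : ℤ) :
    (shift R ^ k) f n = f (n + k) := by
  induction k generalizing n with
  | zero => simp
  | succ k ih =>
    rw [pow_succ', Module.End.mul_apply, shift_apply, ih, Nat.cast_succ, add_right_comm, add_assoc]

lemma exists_weightedShift_pow_apply (k : ℕ) (n : ℤ) :
    ∃ c : MvPolynomial (Fin 2) R, IsRegular c ∧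
      ∀ f, (weightedShift α b γ ^ k) f n = c * f (n - k) := by
  induction k generalizing n with
  | zero => exact ⟨1, isRegular_one, by simp⟩
  | succ k ih =>
    obtain ⟨c, hc, h⟩ := ih (n - 1)
    refine ⟨weight α b γ n * c, (weight_isRegular α b γ n).mul hc, fun f => ?_⟩
    rw [pow_succ', Module.End.mul_apply, weightedShift_apply, h, mul_assoc, Nat.cast_succ, sub_sub,
      add_comm (1 : ℤ)]

lemma exists_tpow_shift_apply_zero (k : ℤ) : ∃ c : MvPolynomial (Fin 2) R, IsRegular c ∧
    ∀ f, tpow (shift R) (weightedShift α b γ) k f 0 = c * f k := by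
  obtain ⟨k, rfl | rfl⟩ := k.eq_nat_or_neg
  · exact ⟨1, isRegular_one, fun f => by simp [shift_pow_apply]⟩
  · obtain ⟨c, hc, h⟩ := exists_weightedShift_pow_apply α b γ k 0
    exact ⟨c, hc, fun f => by simp [h]⟩

theorem linearIndependent_monom :
    LinearIndependent R (monom (d α (b : R) γ) (u α b γ)) := by
  obtain ⟨ρ, hd, hu⟩ := exists_algHom (isDownUpPair_shift α b γ)
  choose c hc h_tpow using exists_tpow_shift_apply_zero α b γ
  let T : DownUpAlgebra α (b : R) γ →ₗ[R] (ℤ → MvPolynomial (Fin 2) R) :=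
    LinearMap.pi fun k => (LinearMap.proj 0) ∘ₗ
      (LinearMap.applyₗ (Pi.single k (1 : MvPolynomial (Fin 2) R))) ∘ₗ ρ.toLinearMap
  have T_monom (i : DownUpExp) : T (monom (d α (b : R) γ) (u α b γ) i) =
      Pi.single i.1 (monomial i.2 1 * c i.1) := by
    ext1 k
    calc T (monom (d α (b : R) γ) (u α b γ) i) k
        = ρ.toRingHom (monom (d α (b : R) γ) (u α b γ) i) (Pi.single k 1) 0 := rfl
      _ = monomial i.2 1 * (c i.1 * Pi.single (M := fun _ => MvPolynomial (Fin 2) R) k 1 i.1) := by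
        rw [map_monom, AlgHom.toRingHom_eq_coe, RingHom.coe_coe, hd, hu,
          ← (isDownUpPair_shift α b γ).polyHom_monomial_mul_tpow, Module.End.mul_apply,
          polyHom_shift_apply_zero, h_tpow]
      _ = _ := by
        rcases eq_or_ne i.1 k with rfl | hk
        · simp
        · simp [hk, hk.symm]
  refine LinearIndependent.of_comp T ?_
  simp only [Function.comp_def, T_monom]
  refine (Pi.linearIndependent_single (R := R) (Ms := fun _ : ℤ => MvPolynomial (Fin 2) R)
    (fun k (m : Fin 2 →₀ ℕ) => monomial m (1 : R) * c k) fun k => ?_).comp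
    (Equiv.sigmaEquivProd ℤ (Fin 2 →₀ ℕ)).symm (Equiv.injective _)
  have := (basisMonomials (Fin 2) R).linearIndependent.map' (LinearMap.mulRight R (c k))
    (LinearMap.ker_eq_bot.mpr (hc k).right)
  simpa [Function.comp_def] using this

end DownUpAlgebra

/-! ### Symbols and adapted bases -/

lemma repr_eq_mapRange_repr {D 𝕜 ι A B : Type*} [CommRing D] [CommRing 𝕜] [Algebra D 𝕜]
    [AddCommGroup A] [Module 𝕜 A] [Module D A] [IsScalarTower D 𝕜 A] [AddCommGroup B] [Module D B]
    {f : B →ₗ[D] A} {bB : Module.Basis ι D B} {bA : Module.Basis ι 𝕜 A} (h : ∀ i, f (bB i) = bA i)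
    (x : B) :
    bA.repr (f x) = (bB.repr x).mapRange (algebraMap D 𝕜) (map_zero _) := by
  have comp_eq : (bA.repr.toLinearMap.restrictScalars D) ∘ₗ f =
      Finsupp.mapRange.linearMap (Algebra.linearMap D 𝕜) ∘ₗ bB.repr.toLinearMap :=
    bB.ext fun i => by simp [h]
  exact LinearMap.congr_fun comp_eq x

lemma IsOrderMap.of_basis {𝕜 : Type*} [Field 𝕜] {D : Subring 𝕜} {A B ι : Type*} [Ring A]
    [Algebra 𝕜 A] [Ring B] [Algebra D B] {f : B →ₐ[D] A} (bB : Module.Basis ι D B)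
    (bA : Module.Basis ι 𝕜 A) (h : ∀ i, f (bB i) = bA i) : IsOrderMap f := by
  refine ⟨fun x y hxy => ?_, Module.Free.of_basis bB, ?_⟩
  · apply bB.repr.injective
    apply Finsupp.mapRange_injective (algebraMap D 𝕜) (map_zero _)
      (FaithfulSMul.algebraMap_injective D 𝕜)
    rw [← repr_eq_mapRange_repr (f := f.toLinearMap) h,
      ← repr_eq_mapRange_repr (f := f.toLinearMap) h]
    exact congrArg bA.repr hxy
  · let e : 𝕜 ⊗[D] B ≃ₗ[𝕜] A := (bB.baseChange 𝕜).equiv bA (Equiv.refl ι)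
    have e_one_tmul : (e.toLinearMap.restrictScalars D) ∘ₗ (TensorProduct.mk D 𝕜 B 1) =
        f.toLinearMap := by
      refine bB.ext fun i => ?_
      calc e (1 ⊗ₜ bB i) = e (bB.baseChange 𝕜 i) := by rw [Module.Basis.baseChange_apply]
        _ = f (bB i) := by rw [Module.Basis.equiv_apply, Equiv.refl_apply, h]
    exact IsBaseChange.of_equiv e (LinearMap.congr_fun e_one_tmul)

namespace NFiltration

variable {R A : Type*} [CommRing R] [Ring A] [Algebra R A] {F : NFiltration R A}

lemma prev_le_toFun (n : ℕ) : F.prev n ≤ F.toFun n := by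
  cases n with
  | zero => exact bot_le
  | succ n => exact F.mono' n

lemma toFun_le_prev {m n : ℕ} (hmn : m < n) : F.toFun m ≤ F.prev n := by
  obtain ⟨n, rfl⟩ := Nat.exists_eq_add_one_of_ne_zero (Nat.ne_zero_of_lt hmn)
  exact monotone_nat_of_le_succ F.mono' (Nat.lt_succ_iff.mp hmn)

variable (F) in
/-- The element `z` of the associated graded ring is the symbol of `a` in degree `n`. A relation is
used because the degree of a product of symbols is then only constrained up to an equation. -/
def IsSymbol (n : ℕ) (a : A) (z : F.AssocGraded) : Prop := ∃ ha, z = F.grOf n (F.symbol n a ha)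

namespace IsSymbol

variable {m n : ℕ} {a a' : A} {z z' : F.AssocGraded}

lemma mul (hz : F.IsSymbol m a z) (hz' : F.IsSymbol n a' z') :
    F.IsSymbol (m + n) (a * a') (z * z') := by
  obtain ⟨ha, rfl⟩ := hz
  obtain ⟨ha', rfl⟩ := hz'
  exact ⟨F.mul_mem' ha ha', F.grOf_mul _ _⟩

lemma pow (hz : F.IsSymbol n a z) (k : ℕ) : F.IsSymbol (n * k) (a ^ k) (z ^ k) := by
  induction k with
  | zero =>
    rw [Nat.mul_zero, pow_zero, pow_zero]
    exact ⟨F.one_mem', rfl⟩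
  | succ k ih =>
    rw [pow_succ, pow_succ, Nat.mul_succ]
    exact ih.mul hz

lemma add (hz : F.IsSymbol n a z) (hz' : F.IsSymbol n a' z') :
    F.IsSymbol n (a + a') (z + z') := by
  obtain ⟨ha, rfl⟩ := hz
  obtain ⟨ha', rfl⟩ := hz'
  exact ⟨add_mem ha ha', (map_add (F.grOf n) _ _).symm⟩

lemma smul (hz : F.IsSymbol n a z) (c : R) : F.IsSymbol n (c • a) (c • z) := by
  obtain ⟨ha, rfl⟩ := hz
  exact ⟨Submodule.smul_mem _ c ha, (map_smul (F.grOf n) c _).symm⟩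

lemma zero_of_mem_prev (ha : a ∈ F.prev n) : F.IsSymbol n a 0 := by
  refine ⟨prev_le_toFun n ha, ?_⟩
  rw [(F.symbol_eq_iff _ (zero_mem _)).mpr (by rwa [sub_zero]), ← symbol_zero, map_zero]

lemma unique (hz : F.IsSymbol n a z) (hz' : F.IsSymbol n a z') : z = z' := by
  obtain ⟨_, rfl⟩ := hz
  obtain ⟨_, rfl⟩ := hz'
  rfl

end IsSymbol

lemma isLocallyFinite_ofGenerators {S : Set A} (hS : Algebra.adjoin R S = ⊤) (hfin : S.Finite) :
    (ofGenerators S hS).IsLocallyFinite := fun n =>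
  Module.Finite.of_fg ((Submodule.fg_span (hfin.insert 1)).pow n)

lemma IsLocallyFinite.finite_grPiece (hF : F.IsLocallyFinite) (n : ℕ) :
    Module.Finite R (F.GrPiece n) :=
  have := hF n
  inferInstanceAs (Module.Finite R (F.toFun n ⧸ (F.prev n).submoduleOf (F.toFun n)))

variable {ι : Type*} {deg : ι → ℕ}

variable (F) in
/-- A family `b` is adapted to the filtration `F`, for the degree function `deg`, if each step
`F n` is spanned by the members of `b` of degree at most `n`. -/
def IsAdapted (b : ι → A) (deg : ι → ℕ) : Prop :=
  ∀ n, F.toFun n = Submodule.span R (b '' {i | deg i ≤ n})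

lemma IsAdapted.mem {b : ι → A} (h : F.IsAdapted b deg) (i : ι) : b i ∈ F.toFun (deg i) := by
  rw [h]
  exact Submodule.subset_span ⟨i, le_refl (deg i), rfl⟩

lemma IsAdapted.isLocallyFinite {b : ι → A} (h : F.IsAdapted b deg)
    (hdeg : ∀ n, {i | deg i ≤ n}.Finite) : F.IsLocallyFinite := fun n => by
  rw [h]
  exact Module.Finite.span_of_finite R ((hdeg n).image b)

lemma IsAdapted.span_range_symbol_eq_top {b : ι → A} (h : F.IsAdapted b deg)
    {z : ι → F.AssocGraded} (hz : ∀ i, F.IsSymbol (deg i) (b i) (z i)) :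
    Submodule.span R (Set.range z) = ⊤ := by
  have exists_mem_span {n : ℕ} {a : A} (ha : a ∈ F.toFun n) :
      ∃ y ∈ Submodule.span R (Set.range z), F.IsSymbol n a y := by
    rw [h] at ha
    induction ha using Submodule.span_induction with
    | mem a ha =>
      obtain ⟨i, hi, rfl⟩ := ha
      rcases (show deg i ≤ n from hi).eq_or_lt with rfl | hlt
      · exact ⟨z i, Submodule.subset_span ⟨i, rfl⟩, hz i⟩
      · exact ⟨0, zero_mem _, .zero_of_mem_prev (toFun_le_prev hlt (h.mem i))⟩
    | zero => exact ⟨0, zero_mem _, .zero_of_mem_prev (zero_mem _)⟩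
    | add a a' _ _ ha ha' =>
      obtain ⟨y, hy, hay⟩ := ha
      obtain ⟨y', hy', hay'⟩ := ha'
      exact ⟨y + y', add_mem hy hy', hay.add hay'⟩
    | smul c a _ ha =>
      obtain ⟨y, hy, hay⟩ := ha
      exact ⟨c • y, Submodule.smul_mem _ c hy, hay.smul c⟩
  refine eq_top_iff.mpr fun x _ => ?_
  induction x using DirectSum.induction_on with
  | zero => exact zero_mem _
  | of n x =>
    obtain ⟨a, ha, rfl⟩ := F.symbol_surj x
    obtain ⟨y, hy, hay⟩ := exists_mem_span ha
    rwa [hay.unique ⟨ha, rfl⟩] at hy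
  | add x y hx hy => exact add_mem (hx trivial) (hy trivial)

section Basis

variable {b : Module.Basis ι R A} (h : F.IsAdapted b deg)

include h in
lemma IsAdapted.filter_repr_eq_zero {n : ℕ} {a : A} (ha : a ∈ F.prev n) :
    (b.repr a).filter (fun i => deg i = n) = 0 := by
  cases n with
  | zero =>
    obtain rfl : a = 0 := ha
    rw [map_zero, Finsupp.filter_zero]
  | succ n =>
    replace ha : a ∈ F.toFun n := ha
    rw [h, Module.Basis.mem_span_image] at ha
    rw [Finsupp.filter_eq_zero_iff]
    intro i hi
    by_contra hne
    have deg_le : deg i ≤ n := ha (Finsupp.mem_support_iff.mpr hne)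
    lia

/-- The coordinates of degree `n`, in a basis adapted to the filtration, of an element of the
`n`-th graded piece. -/
noncomputable def IsAdapted.grPieceRepr (n : ℕ) : F.GrPiece n →ₗ[R] (ι →₀ R) :=
  Submodule.liftQ _
    ((Finsupp.supported R R {i | deg i = n}).subtype ∘ₗ Finsupp.restrictDom R R {i | deg i = n} ∘ₗ
      b.repr.toLinearMap ∘ₗ (F.toFun n).subtype)
    (fun _ ha => h.filter_repr_eq_zero ha)

include h in
lemma IsAdapted.linearIndependent_symbol {z : ι → F.AssocGraded}
    (hz : ∀ i, F.IsSymbol (deg i) (b i) (z i)) : LinearIndependent R z := by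
  let grRepr : F.AssocGraded →ₗ[R] (ι →₀ R) := DirectSum.toModule R ℕ (ι →₀ R) h.grPieceRepr
  refine LinearIndependent.of_comp grRepr ?_
  have grRepr_symbol (i : ι) : grRepr (z i) = Finsupp.single i 1 := by
    obtain ⟨hi, hzi⟩ := hz i
    calc grRepr (z i) = h.grPieceRepr (deg i) (F.symbol (deg i) (b i) hi) := by
          rw [hzi]
          exact DirectSum.toModule_lof R (deg i) _
      _ = (b.repr (b i)).filter (fun j => deg j = deg i) := rfl
      _ = Finsupp.single i 1 := by
          rw [Module.Basis.repr_self, Finsupp.filter_single_of_pos (fun j => deg j = deg i) rfl]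
  rw [show grRepr ∘ z = fun i => Finsupp.single i 1 from funext grRepr_symbol]
  exact Finsupp.linearIndependent_single_one R ι

/-- The basis of the associated graded ring given by the symbols of a basis adapted to the
filtration. -/
noncomputable def IsAdapted.grBasis {z : ι → F.AssocGraded}
    (hz : ∀ i, F.IsSymbol (deg i) (b i) (z i)) : Module.Basis ι R F.AssocGraded :=
  Module.Basis.mk (h.linearIndependent_symbol hz) (h.span_range_symbol_eq_top hz).ge

end Basis

section Induced

variable {𝕜 A ι : Type*} [Field 𝕜] [Ring A] [Algebra 𝕜 A] {F : NFiltration 𝕜 A} {D : Subring 𝕜}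
  {B : Subalgebra D A} {bA : Module.Basis ι 𝕜 A} {bB : Module.Basis ι D B} {deg : ι → ℕ}

lemma IsAdapted.induced (h : F.IsAdapted bA deg) (hb : ∀ i, (bB i : A) = bA i) :
    (F.induced B).IsAdapted bB deg := fun n => by
  ext a
  rw [F.mem_induced, h, Module.Basis.mem_span_image, Module.Basis.mem_span_image,
    show (a : A) = B.val.toLinearMap a from rfl, repr_eq_mapRange_repr hb,
    Finsupp.support_mapRange_of_injective _ _ (FaithfulSMul.algebraMap_injective D 𝕜)]

lemma IsSymbol.grMap {n : ℕ} {a : B} {z : (F.induced B).AssocGraded}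
    (hz : (F.induced B).IsSymbol n a z) : F.IsSymbol n (a : A) (F.grMap B z) := by
  obtain ⟨ha, rfl⟩ := hz
  exact ⟨ha, F.grMap_grOf_symbol B n a ha⟩

theorem IsAdapted.isOrderMap_grMap (h : F.IsAdapted bA deg) (hb : ∀ i, (bB i : A) = bA i) :
    IsOrderMap (F.grMap B) := by
  have h' := h.induced hb
  have isSymbol (i : ι) : (F.induced B).IsSymbol (deg i) (bB i)
    ((F.induced B).grOf (deg i) ((F.induced B).symbol (deg i) (bB i) (h'.mem i))) := ⟨_, rfl⟩
  have isSymbol_map (i : ι) := hb i ▸ (isSymbol i).grMap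
  refine IsOrderMap.of_basis (h'.grBasis isSymbol) (h.grBasis isSymbol_map) fun i => ?_
  simp [IsAdapted.grBasis]

end Induced

end NFiltration

/-! ### Base change and the associated graded ring of a down-up algebra -/

lemma IsLeftRightNoetherian.of_ringEquiv {S T : Type*} [Ring S] [Ring T] (e : S ≃+* T)
    (h : IsLeftRightNoetherian S) : IsLeftRightNoetherian T :=
  have := h.1
  have := h.2
  ⟨isNoetherianRing_of_ringEquiv S e, isNoetherianRing_of_ringEquiv _ e.op⟩

namespace IsDownUpPair

open DownUpExp NFiltration

section BaseChange

variable {R S : Type*} [CommRing R] [Ring S] [Algebra R S] {α β γ : R} {d u : S}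

lemma extendScalars {C : Type*} [CommRing C] [Algebra R C] [Algebra C S] [IsScalarTower R C S]
    (h : IsDownUpPair α β γ d u) :
    IsDownUpPair (algebraMap R C α) (algebraMap R C β) (algebraMap R C γ) d u where
  ddu := by simpa only [algebraMap_smul] using h.ddu
  duu := by simpa only [algebraMap_smul] using h.duu

lemma baseChange (h : IsDownUpPair α β γ d u) (C : Type*) [CommRing C] [Algebra R C] :
    IsDownUpPair (algebraMap R C α) (algebraMap R C β) (algebraMap R C γ)
      ((1 : C) ⊗ₜ[R] d) ((1 : C) ⊗ₜ[R] u) :=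
  (h.map (Algebra.TensorProduct.includeRight : S →ₐ[R] C ⊗[R] S)).extendScalars

lemma adjoin_one_tmul_eq_top (hgen : Algebra.adjoin R {d, u} = ⊤) (C : Type*) [CommRing C]
    [Algebra R C] : Algebra.adjoin C {(1 : C) ⊗ₜ[R] d, (1 : C) ⊗ₜ[R] u} = ⊤ := by
  simpa only [Set.image_pair] using
    Algebra.TensorProduct.adjoin_one_tmul_image_eq_top (A := C) {d, u} hgen

variable {b : Rˣ}

theorem isLeftRightNoetherian_baseChange (h : IsDownUpPair α b γ d u)
    (hgen : Algebra.adjoin R {d, u} = ⊤) (C : Type*) [CommRing C] [Algebra R C]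
    [IsNoetherianRing C] : IsLeftRightNoetherian (C ⊗[R] S) :=
  isLeftRightNoetherian (b := Units.map (algebraMap R C : R →* C) b) (h.baseChange C)
    (adjoin_one_tmul_eq_top hgen C)

theorem isPIAlgebra_baseChange (h : IsDownUpPair α b γ d u)
    (hgen : Algebra.adjoin R {d, u} = ⊤) (C : Type*) [CommRing C] [Algebra R C]
    [Finite C] [Nontrivial C] : IsPIAlgebra C (C ⊗[R] S) :=
  isPIAlgebra (b := Units.map (algebraMap R C : R →* C) b) (h.baseChange C)
    (adjoin_one_tmul_eq_top hgen C)

theorem isStronglyNoetherian {R : Type u} {S : Type w} [CommRing R] [Ring S] [Algebra R S]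
    {α γ : R} {b : Rˣ} {d u : S} (h : IsDownUpPair α b γ d u)
    (hgen : Algebra.adjoin R {d, u} = ⊤) : IsStronglyNoetherian.{v} R S := fun C _ _ _ =>
  (h.isLeftRightNoetherian_baseChange hgen C).of_ringEquiv
    (Algebra.TensorProduct.comm R C S).toRingEquiv

end BaseChange

section Graded

variable {R A : Type*} [CommRing R] [Ring A] [Algebra R A] {α β γ : R} {d u : A}
  {F : NFiltration R A} {d' u' : F.AssocGraded}

lemma isSymbol_monom (hd : F.IsSymbol 1 d d') (hu : F.IsSymbol 1 u u') (i : DownUpExp) :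
    F.IsSymbol i.deg (monom d u i) (monom d' u' i) := by
  have isSymbol_tpow : F.IsSymbol i.1.natAbs (tpow d u i.1) (tpow d' u' i.1) := by
    obtain ⟨k, hk | hk⟩ := i.1.eq_nat_or_neg
    · simpa [hk] using hd.pow k
    · simpa [hk] using hu.pow k
  rw [deg_eq]
  exact (((hu.mul hd).pow _).mul ((hd.mul hu).pow _)).mul isSymbol_tpow

lemma symbol (h : IsDownUpPair α β γ d u) (hd : F.IsSymbol 1 d d') (hu : F.IsSymbol 1 u u') :
    IsDownUpPair α β 0 d' u' := by
  -- The linear terms of the relations have degree one, so they vanish in degree three.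
  have linear_term {a : A} {z : F.AssocGraded} (ha : F.IsSymbol 1 a z) :
      F.IsSymbol 3 (γ • a) ((0 : R) • z) := by
    rw [zero_smul]
    exact .zero_of_mem_prev (toFun_le_prev (by norm_num) (Submodule.smul_mem _ γ ha.choose))
  constructor
  · refine ((hd.pow 2).mul hu).unique ?_
    rw [h.ddu]
    exact ((((hd.mul hu).mul hd).smul α).add ((hu.mul (hd.pow 2)).smul β)).add (linear_term hd)
  · refine (hd.mul (hu.pow 2)).unique ?_
    rw [h.duu]
    exact ((((hu.mul hd).mul hu).smul α).add (((hu.pow 2).mul hd).smul β)).add (linear_term hu)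

end Graded

end IsDownUpPair

/-! ### Congeniality -/

namespace IsDownUpPair

open DownUpExp NFiltration

section MonomialBasis

variable {R S : Type*} [CommRing R] [Ring S] [Algebra R S] {α γ : R} {b : Rˣ} {d u : S}

/-- The basis of standard monomials of an algebra generated by a down-up pair, when these monomials
are linearly independent. -/
noncomputable def monomBasis (h : IsDownUpPair α b γ d u) (hgen : Algebra.adjoin R {d, u} = ⊤)
    (hli : LinearIndependent R (monom d u)) : Module.Basis DownUpExp R S :=
  Module.Basis.mk hli (h.span_range_monom_eq_top hgen).ge

@[simp] lemma coe_monomBasis (h : IsDownUpPair α b γ d u) (hgen : Algebra.adjoin R {d, u} = ⊤)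
    (hli : LinearIndependent R (monom d u)) : ⇑(h.monomBasis hgen hli) = monom d u :=
  Module.Basis.coe_mk _ _

lemma isAdapted_monomBasis (h : IsDownUpPair α b γ d u) (hgen : Algebra.adjoin R {d, u} = ⊤)
    (hli : LinearIndependent R (monom d u)) :
    (ofGenerators {d, u} hgen).IsAdapted (h.monomBasis hgen hli) deg := by
  rw [coe_monomBasis]
  exact h.span_pow_eq_span_monom

lemma adjoin_symbol_eq_top {F : NFiltration R S}
    (hF : F.IsAdapted (monom d u) deg) {d' u' : F.AssocGraded} (hd : F.IsSymbol 1 d d')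
    (hu : F.IsSymbol 1 u u') : Algebra.adjoin R {d', u'} = ⊤ := by
  rw [← Algebra.toSubmodule_eq_top, eq_top_iff,
    ← hF.span_range_symbol_eq_top (isSymbol_monom hd hu), Submodule.span_le]
  rintro _ ⟨i, rfl⟩
  have hd' : d' ∈ Algebra.adjoin R {d', u'} := Algebra.subset_adjoin (Or.inl rfl)
  have hu' : u' ∈ Algebra.adjoin R {d', u'} := Algebra.subset_adjoin (Or.inr rfl)
  change monom d' u' i ∈ Algebra.adjoin R {d', u'}
  exact mul_mem (mul_mem (pow_mem (mul_mem hu' hd') _) (pow_mem (mul_mem hd' hu') _))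
    (mul_mem (pow_mem hd' _) (pow_mem hu' _))

theorem isStronglyNoetherian_assocGraded {R : Type u} {S : Type w} [CommRing R] [Ring S]
    [Algebra R S] {α γ : R} {b : Rˣ} {d u : S} (h : IsDownUpPair α b γ d u) {F : NFiltration R S}
    (hF : F.IsAdapted (monom d u) deg) (hd : d ∈ F.toFun 1) (hu : u ∈ F.toFun 1) :
    IsStronglyNoetherian.{v} R F.AssocGraded :=
  (h.symbol ⟨hd, rfl⟩ ⟨hu, rfl⟩).isStronglyNoetherian
    (adjoin_symbol_eq_top hF ⟨hd, rfl⟩ ⟨hu, rfl⟩)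

end MonomialBasis

theorem isCongenialOrder {𝕜 : Type u} [Field 𝕜] {A : Type w} [Ring A] [Algebra 𝕜 A]
    {D : Subring 𝕜} (hD : Algebra.FiniteType ℤ D) {B : Subalgebra D A} {d u : B} {α γ : D} {b : Dˣ}
    (h : IsDownUpPair α b γ d u) (hgenB : Algebra.adjoin D {d, u} = ⊤)
    (hgenA : Algebra.adjoin 𝕜 {(d : A), (u : A)} = ⊤)
    (hli : LinearIndependent 𝕜 (monom (d : A) (u : A))) :
    IsCongenialOrder.{v} (ofGenerators {(d : A), (u : A)} hgenA) B := by
  have hA : IsDownUpPair (α : 𝕜) (Units.map (algebraMap D 𝕜 : D →* 𝕜) b) (γ : 𝕜) (d : A) (u : A) :=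
    (h.map B.val).extendScalars
  have coe_monom (i : DownUpExp) : ((monom d u i : B) : A) = monom (d : A) (u : A) i :=
    map_monom d u B.val.toRingHom i
  have hliB : LinearIndependent D (monom d u) := by
    refine .of_comp B.val.toLinearMap ?_
    rw [show B.val.toLinearMap ∘ monom d u = monom (d : A) (u : A) from funext coe_monom]
    exact hli.restrict_scalars' D
  have basis_eq (i : DownUpExp) :
      ((h.monomBasis hgenB hliB i : B) : A) = hA.monomBasis hgenA hli i := by
    simp only [coe_monomBasis, coe_monom]
  have adapted := hA.isAdapted_monomBasis hgenA hli
  have adaptedB := adapted.induced basis_eq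
  have mem_one {a : B} (ha : (a : A) ∈ ({(d : A), (u : A)} : Set A)) :
      a ∈ ((ofGenerators {(d : A), (u : A)} hgenA).induced B).toFun 1 := by
    simpa [mem_induced, ofGenerators] using
      Submodule.subset_span (R := 𝕜) (Set.mem_insert_of_mem (1 : A) ha)
  exact
    { affine := hD
      order := .of_basis _ _ basis_eq
      locallyFinite := adaptedB.isLocallyFinite finite_deg_le
      gr_order := adapted.isOrderMap_grMap basis_eq
      gr_stronglyNoetherian := h.isStronglyNoetherian_assocGraded
        (h.coe_monomBasis hgenB hliB ▸ adaptedB) (mem_one (Or.inl rfl)) (mem_one (Or.inr rfl))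
      gr_locallyFinite := (adaptedB.isLocallyFinite finite_deg_le).finite_grPiece
      affine_residue := fun I _ _ => ⟨Subalgebra.fg_def.mpr
        ⟨_, Set.toFinite _, adjoin_one_tmul_eq_top hgenB (D ⧸ I)⟩⟩
      noetherian_residue := fun I _ _ => h.isLeftRightNoetherian_baseChange hgenB (D ⧸ I)
      pi_residue := fun I hI _ =>
        have := hI.nontrivial
        h.isPIAlgebra_baseChange hgenB (D ⧸ I) }

end IsDownUpPair

lemma adjoin_pair_restrict_eq_top {R A : Type*} [CommRing R] [Ring A] [Algebra R A] (a b : A) :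
    Algebra.adjoin R {(⟨a, Algebra.subset_adjoin (Or.inl rfl)⟩ : Algebra.adjoin R {a, b}),
      ⟨b, Algebra.subset_adjoin (Or.inr rfl)⟩} = ⊤ := by
  rw [← Algebra.adjoin_adjoin_coe_preimage (R := R) (s := {a, b})]
  congr 1
  ext ⟨z, hz⟩
  simp [Subtype.ext_iff]

lemma exists_finiteType_subring {K : Type*} [CommRing K] (s : Finset K) :
    ∃ D : Subring K, (s : Set K) ⊆ D ∧ Algebra.FiniteType ℤ D :=
  ⟨(Algebra.adjoin ℤ (s : Set K)).toSubring, Algebra.subset_adjoin,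
    (Subalgebra.fg_iff_finiteType _).mp ⟨s, rfl⟩⟩

theorem mainTheorem7_general {𝕜 : Type u} [Field 𝕜] (α β γ : 𝕜) (hβ : β ≠ 0) :
    IsCongenial.{v} (DownUpAlgebra.standardFiltration α β γ) := by
  classical
  refine ⟨NFiltration.isLocallyFinite_ofGenerators _ (Set.toFinite _), ?_⟩
  obtain ⟨D, hsD, hD⟩ := exists_finiteType_subring {α, β, β⁻¹, γ}
  have hα : α ∈ D := hsD (by simp)
  have hγ : γ ∈ D := hsD (by simp)
  let b : Dˣ := ⟨⟨β, hsD (by simp)⟩, ⟨β⁻¹, hsD (by simp)⟩, Subtype.ext (mul_inv_cancel₀ hβ),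
    Subtype.ext (inv_mul_cancel₀ hβ)⟩
  let B := Algebra.adjoin D {DownUpAlgebra.d α β γ, DownUpAlgebra.u α β γ}
  let d : B := ⟨DownUpAlgebra.d α β γ, Algebra.subset_adjoin (Or.inl rfl)⟩
  let u : B := ⟨DownUpAlgebra.u α β γ, Algebra.subset_adjoin (Or.inr rfl)⟩
  have pair : IsDownUpPair (⟨α, hα⟩ : D) b ⟨γ, hγ⟩ d u :=
    ⟨Subtype.ext (DownUpAlgebra.isDownUpPair α β γ).ddu,
      Subtype.ext (DownUpAlgebra.isDownUpPair α β γ).duu⟩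
  exact ⟨D, B, pair.isCongenialOrder hD (adjoin_pair_restrict_eq_top _ _)
    (DownUpAlgebra.adjoin_d_u α β γ)
    (DownUpAlgebra.linearIndependent_monom α (Units.mk0 β hβ) γ)⟩

theorem mainTheorem7 {𝕜 : Type u} [Field 𝕜] [IsAlgClosed 𝕜] [CharZero 𝕜]
    (α β γ r s : 𝕜) (hβ : β ≠ 0)
    (hroots : (Polynomial.X ^ 2 - Polynomial.C α * Polynomial.X - Polynomial.C β).roots = {r, s})
    (hr : IsOfFinOrder r) (hr2 : 2 ≤ orderOf r)
    (hs : IsOfFinOrder s) (hs2 : 2 ≤ orderOf s) :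
    IsCongenial.{v} (DownUpAlgebra.standardFiltration α β γ) :=
  mainTheorem7_general α β γ hβ
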